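/- **Setting.** Let $(\Omega,d,\mu)$ be a connected metric space equipped with a separable, non-atomic Borel probability measure $\mu$. For a Lipschitz function $f:\Omega\to\mathbb R$ (briefly $f\in Lip(\Omega)$) put $|\nabla f|(x)=\limsup_{y\to x}\frac{|f(x)-f(y)|}{d(x,y)}$, and for a Borel set $A$ put $\mu^+(A)=\liminf_{h\to0^+}\frac{\mu(A_h)-\mu(A)}{h}$ with $A_h=\{x: d(x,A)<h\}$. Let $I_\mu(t)=\inf\{\mu^+(A):A \text{ Borel},\ \mu(A)=t\}$ be the isoperimetric profile. Assume: * for every $f\in Lip(\Omega)$ and every $c\in\mathbb R$, $|\nabla f|=0$ $\mu$-a.e. on $\{f=c\}$; * $I:[0,1]\to[0,\infty)$ is a convex isoperimetric estimator, i.e. $I$ is continuous, convex and increasing on $(0,1/2)$, symmetric about $1/2$, $I(0)=0$, $I>0$ on $(0,1)$, and $I_\mu(t)\ge I(t)$ for $0\le t\le1$. For a measurable function $u$ let $u^*(s)=\inf\{t\ge0:\mu\{|u|>t\}\le s\}$, $0<s<1$, be its decreasing rearrangement (on $(0,1)$, with respect to Lebesgue measure). A *rearrangement invariant (r.i.) space*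 $X$ on $\Omega$ is a Banach function space (its norm is a lattice norm with the Fatou property, finite on indicator functions of measurable sets, and $\int_E|u|\,d\mu\le C_E\|u\|_X$ for measurable $E$) such that $\|u\|_X=\|v\|_X$ whenever $u^*=v^*$. Its representation space $\bar X$ on $(0,1)$, for which $\|u\|_X=\|u^*\|_{\bar X}$, has the norm $$\|f\|_{\bar X}=\sup\Big\{\int_0^1 f^*(s)w^*(s)\,ds:\ \|w\|_{X'}\le1\Big\},\qquad \|w\|_{X'}=\sup\Big\{\int_\Omega|uw|\,d\mu:\ \|u\|_X\le1\Big\}.$$ A *quasi-r.i. space* $Y$ on $(0,1)$ is a complete quasi-normed space of (classes of) measurable functions on $(0,1)$ such that if $f\in Y$ and $g$ is measurable with $f^*=g^*$, then $g\in Y$ and $\|f\|_Y=\|g\|_Y$. The norm or quasi-norm of a measurable function outside the space is $\infty$. The isoperimetric Hardy operator is $Q_If(t)=\int_t^{1/2}f(s)\frac{ds}{I(s)}$ for $0<t<1/2$, and $Q_If(t)=0$ for $1/2\le t<1$. **Theorem.** Let $Y$ be a quasi-r.i. space on $(0,1)$ and $X$ an r.i. space on $\Omega$. Assume that there is a constant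 $C>0$ such that $\|Q_If\|_Y\le C\|f\|_{\bar X}$ for all measurable $f$ on $(0,1)$. Then there is a constant $K<\infty$ such that for all $g\in Lip(\Omega)$ $$\inf_{c\in\mathbb R}\|(g-c)^*\|_Y\le K\,\big\|\,|\nabla g|\,\big\|_X .$$ -/

import Mathlib

open MeasureTheory Set Filter Topology
open scoped ENNReal NNReal

namespace ConvexIso

noncomputable section

/-- The modulus of the gradient `|∇f|(x) = limsup_{y → x} |f x - f y| / d(x, y)`. -/
def gradMod {Ω : Type*} [MetricSpace Ω] (f : Ω → ℝ) (x : Ω) : ℝ≥0∞ :=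
  limsup (fun y => ENNReal.ofReal |f x - f y| / edist x y) (𝓝[≠] x)

/-- The perimeter (Minkowski content) `μ⁺(A) = liminf_{h → 0⁺} (μ(A_h) - μ(A)) / h`, where `A_h` is
the open `h`-neighbourhood of `A`. -/
def perimeter {Ω : Type*} [MetricSpace Ω] [MeasurableSpace Ω] (μ : Measure Ω) (A : Set Ω) : ℝ≥0∞ :=
  liminf (fun h : ℝ => (μ (Metric.thickening h A) - μ A) / ENNReal.ofReal h) (𝓝[>] 0)

/-- The isoperimetric profile: the largest function `I_μ` with `μ⁺(A) ≥ I_μ(μ(A))` for all Borel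
sets `A`. -/
def isoProfile {Ω : Type*} [MetricSpace Ω] [MeasurableSpace Ω] (μ : Measure Ω) (t : ℝ) : ℝ≥0∞ :=
  ⨅ (A : Set Ω) (_ : MeasurableSet A) (_ : μ A = ENNReal.ofReal t), perimeter μ A

/-- `I` (of which only the values on `[0, 1]` matter) is a convex isoperimetric estimator: it is
continuous, convex and increasing on the left half of `[0, 1]`, symmetric about `1/2`, zero at `0`,
positive on `(0, 1)`, and bounded above by the isoperimetric profile. -/
structure IsConvexEstimator {Ω : Type*} [MetricSpace Ω] [MeasurableSpace Ω] (μ : Measure Ω)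
    (I : ℝ → ℝ) : Prop where
  continuousOn : ContinuousOn I (Icc 0 1)
  convexOn : ConvexOn ℝ (Ioo 0 (1 / 2)) I
  monotoneOn : MonotoneOn I (Ioo 0 (1 / 2))
  symm : ∀ t ∈ Icc (0 : ℝ) 1, I (1 - t) = I t
  zero : I 0 = 0
  pos : ∀ t ∈ Ioo (0 : ℝ) 1, 0 < I t
  le_profile : ∀ t ∈ Icc (0 : ℝ) 1, ENNReal.ofReal (I t) ≤ isoProfile μ t

/-- A measure without atoms: every measurable set of positive measure has a measurable subset of
strictly smaller positive measure. -/
def NonAtomic {Ω : Type*} [MeasurableSpace Ω] (μ : Measure Ω) : Prop :=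
  ∀ A, MeasurableSet A → 0 < μ A → ∃ B ⊆ A, MeasurableSet B ∧ 0 < μ B ∧ μ B < μ A

/-- The decreasing rearrangement `u*(s) = inf {t ≥ 0 : μ {u > t} ≤ s}` of a nonnegative function
`u`; the rearrangement of a real function `f` is that of `|f|`. -/
def rearr {Ω : Type*} [MeasurableSpace Ω] (μ : Measure Ω) (u : Ω → ℝ≥0∞) (s : ℝ) : ℝ≥0∞ :=
  sInf {t : ℝ≥0∞ | μ {x | t < u x} ≤ ENNReal.ofReal s}

/-- Lebesgue measure on `(0, 1)`. -/
abbrev leb : Measure ℝ := volume.restrict (Ioo (0 : ℝ) 1)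

/-- A rearrangement invariant Banach function space over a probability space, given by its function
norm on nonnegative measurable functions; a function `f` belongs to the space when
`norm |f| < ∞`. -/
structure RISpace {Ω : Type*} [MeasurableSpace Ω] (μ : Measure Ω) [IsProbabilityMeasure μ] where
  norm : (Ω → ℝ≥0∞) → ℝ≥0∞
  norm_eq_zero : ∀ u, AEMeasurable u μ → (norm u = 0 ↔ u =ᵐ[μ] 0)
  norm_smul : ∀ (a : ℝ≥0) (u), AEMeasurable u μ → norm (fun x => a * u x) = a * norm u
  norm_add_le : ∀ u v, AEMeasurable u μ → AEMeasurable v μ →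
    norm (fun x => u x + v x) ≤ norm u + norm v
  norm_mono : ∀ u v, AEMeasurable u μ → AEMeasurable v μ → u ≤ᵐ[μ] v → norm u ≤ norm v
  /-- the Fatou property -/
  norm_iSup : ∀ u : ℕ → Ω → ℝ≥0∞, (∀ n, AEMeasurable (u n) μ) → Monotone u →
    norm (fun x => ⨆ n, u n x) = ⨆ n, norm (u n)
  norm_indicator_lt_top : ∀ E, MeasurableSet E → norm (E.indicator 1) < ∞
  lintegral_le : ∀ E, MeasurableSet E → ∃ C : ℝ≥0, ∀ u, AEMeasurable u μ →
    ∫⁻ x in E, u x ∂μ ≤ C * norm u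
  /-- rearrangement invariance -/
  norm_congr : ∀ u v, AEMeasurable u μ → AEMeasurable v μ →
    (∀ s ∈ Ioo (0 : ℝ) 1, rearr μ u s = rearr μ v s) → norm u = norm v

/-- The associate norm `‖w‖_{X'} = sup {∫ u w dμ : ‖u‖_X ≤ 1}`. -/
def RISpace.assocNorm {Ω : Type*} [MeasurableSpace Ω] {μ : Measure Ω} [IsProbabilityMeasure μ]
    (X : RISpace μ) (w : Ω → ℝ≥0∞) : ℝ≥0∞ :=
  ⨆ (u : Ω → ℝ≥0∞) (_ : AEMeasurable u μ) (_ : X.norm u ≤ 1), ∫⁻ x, u x * w x ∂μ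

/-- The norm of the representation space `X̄` of `X` on `(0, 1)` (Luxemburg representation):
`‖f‖_X̄ = sup {∫₀¹ f*(s) w*(s) ds : ‖w‖_{X'} ≤ 1}`. -/
def RISpace.barNorm {Ω : Type*} [MeasurableSpace Ω] {μ : Measure Ω} [IsProbabilityMeasure μ]
    (X : RISpace μ) (f : ℝ → ℝ) : ℝ≥0∞ :=
  ⨆ (w : Ω → ℝ≥0∞) (_ : AEMeasurable w μ) (_ : X.assocNorm w ≤ 1),
    ∫⁻ s in Ioo (0 : ℝ) 1, rearr leb (fun t => ENNReal.ofReal |f t|) s * rearr μ w s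

/-- A quasi-Banach rearrangement invariant space of Lebesgue measurable functions on `(0, 1)`. The
space consists of the measurable `f` with `norm f < ∞`. -/
structure QRISpace where
  norm : (ℝ → ℝ) → ℝ≥0∞
  norm_eq_zero : ∀ f, AEMeasurable f leb → (norm f = 0 ↔ f =ᵐ[leb] 0)
  norm_smul : ∀ (a : ℝ) (f), AEMeasurable f leb →
    norm (fun t => a * f t) = ENNReal.ofReal |a| * norm f
  /-- the triangle inequality up to a constant -/
  norm_add_le : ∃ K : ℝ≥0, ∀ f g, AEMeasurable f leb → AEMeasurable g leb →
    norm (fun t => f t + g t) ≤ K * (norm f + norm g)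
  /-- completeness -/
  complete : ∀ f : ℕ → ℝ → ℝ, (∀ n, AEMeasurable (f n) leb ∧ norm (f n) < ∞) →
    (∀ ε : ℝ≥0∞, 0 < ε → ∃ N, ∀ m ≥ N, ∀ n ≥ N, norm (fun t => f m t - f n t) < ε) →
    ∃ g, AEMeasurable g leb ∧ norm g < ∞ ∧
      Tendsto (fun n => norm (fun t => f n t - g t)) atTop (𝓝 0)
  /-- rearrangement invariance -/
  norm_congr : ∀ f g, AEMeasurable f leb → AEMeasurable g leb →
    (∀ s ∈ Ioo (0 : ℝ) 1, rearr leb (fun t => ENNReal.ofReal |f t|) s =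
      rearr leb (fun t => ENNReal.ofReal |g t|) s) → norm f = norm g

/-- The isoperimetric Hardy operator `Q_I f(t) = ∫_t^{1/2} f(s) ds / I(s)` for `0 < t < 1/2`,
extended by zero. -/
def hardyQ (I f : ℝ → ℝ) : ℝ → ℝ :=
  (Ioo (0 : ℝ) (1 / 2)).indicator fun t => ∫ s in t..(1 / 2), f s / I s

end

end ConvexIso

namespace ConvexIso

/-! ### Rearrangements, equimeasurability and the rank map -/

section Rearrangement

variable {S : Type*} [MeasurableSpace S]

/-! Split `g` at a median `m` into `(g - m)⁺` and `(m - g)⁺`. Each part `f` is nonnegative,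
Lipschitz and supported on a set of measure at most `1/2`. The core is to write `f*` on `(0, 1/2)`
as `Q_I h`, with `h` controlled by `|∇f|` in the representation space (`exists_hardyQ_eq_rearr`).
Formally `h = I · (-f*)'`.

To construct `h` without differentiating `f*`, replace `-df*` by `levelMeasure`, the image of
Lebesgue measure under the distribution function of `f`, and multiply it by `I`. The coarea
inequality with the isoperimetric estimator dominates the result by the image of `|∇f| μ` under the
rank `x ↦ μ {f > f x}` (`lintegral_withDensity_levelMeasure_le`). The gradient vanishes a.e. on
level sets of positive measure, and off these the rank pushes `μ` to a measure below Lebesgue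
measure (`map_rank_restrict_le`). Hence the weighted measure has a density bounded by the Lipschitz
constant, and this density is `h`.

For the norm estimate, pair `h` with a rearranged copy of `w*`, pull the copy back to `Ω` by the
rank, and apply Hardy–Littlewood. Then `RISpace.lintegral_rearr_mul_rearr_le_norm` bounds the
pairing by the norm of the gradient; here non-atomicity supplies measure preserving maps from `Ω` to
`(0, 1)`. Finally `|g - m|*` is equimeasurable with the rearrangement of one part plus the
reflection of the other, so the quasi-triangle inequality of `Y` and the boundedness of `Q_I` finish
the proof. -/

theorem rearr_le_iff (m : Measure S) (u : S → ℝ≥0∞) (s : ℝ) (t : ℝ≥0∞) :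
    rearr m u s ≤ t ↔ m {x | t < u x} ≤ ENNReal.ofReal s := by
  refine ⟨fun h => ?_, fun h => sInf_le h⟩
  rcases eq_or_ne t ∞ with rfl | ht
  · simp
  -- The infimum is attained: the distribution function is right-continuous, by continuity of the
  -- measure along levels decreasing to `t`.
  obtain ⟨a, ha, hta, hat⟩ := exists_seq_strictAnti_tendsto' (lt_top_iff_ne_top.2 ht)
  have hU : {x | t < u x} = ⋃ n, {x | a n < u x} := by
    ext x
    simp only [mem_ofPred_eq, mem_iUnion]
    refine ⟨fun hx => ((hat.eventually_lt_const hx).exists), fun ⟨n, hn⟩ => (hta n).1.trans hn⟩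
  have hm : Monotone fun n => {x | a n < u x} := fun i j hij x hx =>
    (ha.antitone hij).trans_lt hx
  rw [hU, hm.measure_iUnion]
  refine iSup_le fun n => ?_
  obtain ⟨r, hr, hrn⟩ := sInf_lt_iff.1 (h.trans_lt (hta n).1)
  exact (measure_mono fun x hx => hrn.trans hx).trans hr

theorem lt_rearr_iff (m : Measure S) (u : S → ℝ≥0∞) (s : ℝ) (t : ℝ≥0∞) :
    t < rearr m u s ↔ ENNReal.ofReal s < m {x | t < u x} := by
  simpa using (rearr_le_iff m u s t).not

theorem rearr_antitone (m : Measure S) (u : S → ℝ≥0∞) : Antitone (rearr m u) := fun s t hst =>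
  (rearr_le_iff m u t _).2 <|
    ((rearr_le_iff m u s _).1 le_rfl).trans (ENNReal.ofReal_le_ofReal hst)

theorem measurable_rearr (m : Measure S) (u : S → ℝ≥0∞) : Measurable (rearr m u) :=
  (rearr_antitone m u).measurable

theorem leb_setOf_ofReal_lt (a : ℝ≥0∞) (ha : a ≤ 1) :
    leb {s | ENNReal.ofReal s < a} = a := by
  have hfin : a ≠ ∞ := (ha.trans_lt ENNReal.one_lt_top).ne
  have h1 : a.toReal ≤ 1 := ENNReal.toReal_le_of_le_ofReal zero_le_one (by simpa using ha)
  have : {s : ℝ | ENNReal.ofReal s < a} ∩ Ioo 0 1 = Ioo 0 a.toReal := by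
    ext s
    simp only [mem_inter_iff, mem_ofPred_eq, mem_Ioo]
    constructor
    · rintro ⟨h, h0, -⟩
      exact ⟨h0, (ENNReal.ofReal_lt_iff_lt_toReal h0.le hfin).1 h⟩
    · rintro ⟨h0, h⟩
      exact ⟨(ENNReal.ofReal_lt_iff_lt_toReal h0.le hfin).2 h, h0, h.trans_le h1⟩
  rw [Measure.restrict_apply' measurableSet_Ioo, this, Real.volume_Ioo, sub_zero,
    ENNReal.ofReal_toReal hfin]

instance isProbabilityMeasure_leb : IsProbabilityMeasure leb := ⟨by simp [leb]⟩

/-- By `lt_rearr_iff`, the superlevel set meets `(0, 1)` in an initial interval whose length is the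
distribution function at `t`. -/
theorem leb_setOf_lt_rearr (m : Measure S) [IsProbabilityMeasure m] (u : S → ℝ≥0∞) (t : ℝ≥0∞) :
    leb {s | t < rearr m u s} = m {x | t < u x} := by
  simp_rw [lt_rearr_iff]
  exact leb_setOf_ofReal_lt _ prob_le_one

theorem rearr_congr {S' : Type*} [MeasurableSpace S'] {m : Measure S} {m' : Measure S'}
    {u : S → ℝ≥0∞} {u' : S' → ℝ≥0∞} (h : ∀ t, m {x | t < u x} = m' {x | t < u' x}) :
    rearr m u = rearr m' u' := by
  ext s
  simp [rearr, h]

theorem rearr_congr_ae {m : Measure S} {u v : S → ℝ≥0∞} (h : u =ᵐ[m] v) :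
    rearr m u = rearr m v :=
  rearr_congr fun t => measure_congr <| by
    filter_upwards [h] with x hx
    exact congrArg (t < ·) hx

theorem rearr_comp_measurePreserving {m : Measure S} [IsProbabilityMeasure m] {S' : Type*}
    [MeasurableSpace S'] {m' : Measure S'} {σ : S' → ℝ} (hσ : MeasurePreserving σ m' leb)
    (u : S → ℝ≥0∞) : rearr m' (rearr m u ∘ σ) = rearr m u := by
  refine rearr_congr fun t => ?_
  rw [← leb_setOf_lt_rearr m u t]
  exact hσ.measure_preimage (measurableSet_lt measurable_const
    (measurable_rearr m u)).nullMeasurableSet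

theorem map_rearr (m : Measure S) [IsProbabilityMeasure m] {u : S → ℝ≥0∞} (hu : Measurable u) :
    leb.map (rearr m u) = m.map u := by
  have := Measure.isProbabilityMeasure_map (μ := m) hu.aemeasurable
  have := Measure.isProbabilityMeasure_map (μ := leb) (measurable_rearr m u).aemeasurable
  refine Measure.ext_of_Iic _ _ fun t => ?_
  rw [← compl_Ioi, prob_compl_eq_one_sub measurableSet_Ioi, prob_compl_eq_one_sub measurableSet_Ioi,
    Measure.map_apply (measurable_rearr m u) measurableSet_Ioi, Measure.map_apply hu measurableSet_Ioi]
  exact congrArg (1 - ·) (leb_setOf_lt_rearr m u t)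

/-- The rank of a point `x` with respect to `u`: the measure of the set where `u` exceeds `u x`. -/
noncomputable def rank (m : Measure S) (u : S → ℝ≥0∞) (x : S) : ℝ := (m {y | u x < u y}).toReal

/-- The points lying on null level sets of `u`. -/
def nullLevel (m : Measure S) (u : S → ℝ≥0∞) : Set S := {x | m {y | u y = u x} = 0}

theorem countable_setOf_measure_singleton_ne_zero {T : Type*} [MeasurableSpace T]
    [MeasurableSingletonClass T] (ρ : Measure T) [IsFiniteMeasure ρ] :
    {c | ρ {c} ≠ 0}.Countable := by
  have := Measure.countable_meas_pos_of_disjoint_iUnion (μ := ρ) (As := fun c : T => {c})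
    (fun c => measurableSet_singleton c) (fun a b hab => by simpa using hab)
  simpa [pos_iff_ne_zero] using this

theorem measurable_rank (m : Measure S) {u : S → ℝ≥0∞} (hu : Measurable u) :
    Measurable (rank m u) := by
  have : Measurable fun c : ℝ≥0∞ => m {y | c < u y} :=
    Antitone.measurable fun a b hab => measure_mono fun y hy => hab.trans_lt hy
  exact (this.comp hu).ennreal_toReal

theorem nullLevel_eq_preimage (m : Measure S) {u : S → ℝ≥0∞} (hu : Measurable u) :
    nullLevel m u = u ⁻¹' {c | m.map u {c} = 0} := by
  ext x
  simp only [nullLevel, mem_ofPred_eq, mem_preimage]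
  rw [Measure.map_apply hu (measurableSet_singleton _)]
  rfl

theorem measurableSet_map_singleton_eq_zero (m : Measure S) [IsFiniteMeasure m] (u : S → ℝ≥0∞) :
    MeasurableSet {c | m.map u {c} = 0} := by
  have := (countable_setOf_measure_singleton_ne_zero (m.map u)).measurableSet.compl
  simpa [compl_ofPred] using this

theorem measurableSet_nullLevel (m : Measure S) [IsFiniteMeasure m] {u : S → ℝ≥0∞}
    (hu : Measurable u) : MeasurableSet (nullLevel m u) := by
  rw [nullLevel_eq_preimage m hu]
  exact hu (measurableSet_map_singleton_eq_zero m u)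

/-- In general the distribution function at `u*(t)` is at most `t`. For the converse, `(0, t)` lies
in the weak superlevel set of `u*` at that value, and weak and strict superlevel sets agree in
measure at a value that is not an atom. -/
theorem measure_lt_rearr_of_null (m : Measure S) [IsProbabilityMeasure m] {u : S → ℝ≥0∞}
    (hu : Measurable u) {t : ℝ} (ht : t ∈ Ioo (0 : ℝ) 1) (h0 : m.map u {rearr m u t} = 0) :
    (m {y | rearr m u t < u y}).toReal = t := by
  have hle : m {y | rearr m u t < u y} ≤ ENNReal.ofReal t := (rearr_le_iff m u t _).1 le_rfl
  have hge : ENNReal.ofReal t ≤ m {y | rearr m u t < u y} := by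
    have h1 : m {y | rearr m u t < u y} = m.map u (Ici (rearr m u t)) := by
      rw [← measure_congr (Ioi_ae_eq_Ici' h0), Measure.map_apply hu measurableSet_Ioi]
      rfl
    rw [h1, ← map_rearr m hu, Measure.map_apply (measurable_rearr m u) measurableSet_Ici]
    calc ENNReal.ofReal t = leb (Ioo 0 t) := by
          rw [Measure.restrict_apply measurableSet_Ioo, Ioo_inter_Ioo]
          simp [ht.2.le]
      _ ≤ _ := measure_mono fun s hs => rearr_antitone m u hs.2.le
  rw [le_antisymm hle hge, ENNReal.toReal_ofReal ht.1.le]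

/-- The rank is the distribution function `T` composed with `u`. Since `u` and `u*` have the same
law, the computation moves to `(0, 1)`, where `T ∘ u*` is the identity over the non-atomic values.
The image is thus Lebesgue measure restricted to a subset. -/
theorem map_rank_restrict_le (m : Measure S) [IsProbabilityMeasure m] {u : S → ℝ≥0∞}
    (hu : Measurable u) : (m.restrict (nullLevel m u)).map (rank m u) ≤ leb := by
  set T : ℝ≥0∞ → ℝ := fun c => (m {y | c < u y}).toReal with hT
  have hTm : Measurable T := by
    have : Measurable fun c : ℝ≥0∞ => m {y | c < u y} :=
      Antitone.measurable fun a b hab => measure_mono fun y hy => hab.trans_lt hy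
    exact this.ennreal_toReal
  have hN := measurableSet_map_singleton_eq_zero m u
  set N := {c | m.map u {c} = 0} with hNdef
  have hr := measurable_rearr m u
  have e1 : (m.restrict (nullLevel m u)).map (rank m u) = ((m.map u).restrict N).map T := by
    rw [nullLevel_eq_preimage m hu, Measure.restrict_map hu hN, Measure.map_map hTm hu]
    rfl
  have e2 : ((m.map u).restrict N).map T = leb.restrict (rearr m u ⁻¹' N) := by
    rw [← map_rearr m hu, Measure.restrict_map hr hN, Measure.map_map hTm hr]
    have : T ∘ rearr m u =ᵐ[leb.restrict (rearr m u ⁻¹' N)] id := by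
      rw [Filter.EventuallyEq, ae_restrict_iff' (hr hN)]
      filter_upwards [ae_restrict_mem measurableSet_Ioo] with t ht htN
      exact measure_lt_rearr_of_null m hu ht htN
    rw [Measure.map_congr this, Measure.map_id]
  rw [e1, e2]
  exact Measure.restrict_le_self

theorem measurePreserving_rank (m : Measure S) [IsProbabilityMeasure m] {u : S → ℝ≥0∞}
    (hu : Measurable u) (h0 : ∀ c, m {y | u y = c} = 0) : MeasurePreserving (rank m u) m leb := by
  refine ⟨measurable_rank m hu, ?_⟩
  have hN : nullLevel m u = univ := eq_univ_of_forall fun x => h0 _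
  have h := map_rank_restrict_le m hu
  rw [hN, Measure.restrict_univ] at h
  have := Measure.isProbabilityMeasure_map (μ := m) (measurable_rank m hu).aemeasurable
  exact Measure.eq_of_le_of_measure_univ_eq h (by simp)

end Rearrangement


/-! ### Measure preserving maps to the interval, Hardy–Littlewood and Hölder -/

section Transport

variable {S : Type*} [MeasurableSpace S]

open scoped symmDiff in
/-- A separable non-atomic measure carries a measurable real function all of whose level sets are
null. -/
theorem NonAtomic.exists_measurable_null_levels {μ : Measure S} [IsFiniteMeasure μ]
    [MeasureTheory.IsSeparable μ] (hμ : NonAtomic μ) :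
    ∃ v : S → ℝ, Measurable v ∧ ∀ c, μ {x | v x = c} = 0 := by
  classical
  obtain ⟨𝒜, h𝒜c, h𝒜⟩ := exists_countable_measureDense (μ := μ)
  obtain ⟨D, hD⟩ := h𝒜c.exists_eq_range h𝒜.nonempty
  have hDm : ∀ n, MeasurableSet (D n) := fun n => h𝒜.measurable _ (hD ▸ mem_range_self n)
  -- Each point is coded by its memberships in a countable measure-dense family. A level set of
  -- positive measure would be split by non-atomicity, although no `D n` splits it.
  set ψ : S → ℕ → Bool := fun x n => decide (x ∈ D n) with hψ
  have hψm : Measurable ψ := measurable_pi_iff.2 fun n => by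
    refine measurable_to_bool ?_
    convert hDm n using 1
    ext x
    simp [hψ]
  obtain ⟨e, he⟩ := exists_measurableEmbedding_real (ℕ → Bool)
  refine ⟨e ∘ ψ, he.measurable.comp hψm, fun c => ?_⟩
  by_contra hpos
  have hAm : MeasurableSet {x | (e ∘ ψ) x = c} :=
    (he.measurable.comp hψm) (measurableSet_singleton c)
  set A := {x | (e ∘ ψ) x = c} with hA
  obtain ⟨B, hBA, hBm, hB0, hBlt⟩ := hμ A hAm (pos_iff_ne_zero.2 hpos)
  have hdiff : 0 < μ (A \ B) := by
    rw [measure_sdiff hBA hBm.nullMeasurableSet (measure_ne_top _ _)]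
    exact tsub_pos_of_lt hBlt
  set ε := min (μ B) (μ (A \ B)) with hε
  have hε0 : 0 < ε := lt_min hB0 hdiff
  have hεtop : ε ≠ ∞ := ((min_le_left _ _).trans_lt (measure_lt_top _ _)).ne
  obtain ⟨t, ht, hlt⟩ := h𝒜.approx B hBm (measure_ne_top _ _) ε.toReal
    (ENNReal.toReal_pos hε0.ne' hεtop)
  rw [ENNReal.ofReal_toReal hεtop] at hlt
  obtain ⟨n, rfl⟩ : t ∈ range D := hD ▸ ht
  have hconst : ∀ x ∈ A, ∀ y ∈ A, (x ∈ D n ↔ y ∈ D n) := fun x hx y hy => by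
    have : ψ x = ψ y := he.injective (hx.trans hy.symm)
    simpa [hψ] using congrFun this n
  -- `D n` contains `A` or misses it, so its symmetric difference with `B` includes `A \ B` or `B`,
  -- of measure at least `ε`.
  refine hlt.not_ge ?_
  by_cases hne : ∃ x ∈ A, x ∈ D n
  · obtain ⟨x, hx, hxD⟩ := hne
    exact (min_le_right _ _).trans (measure_mono fun y hy =>
      Or.inr ⟨(hconst x hx y hy.1).1 hxD, hy.2⟩)
  · push Not at hne
    exact (min_le_left _ _).trans (measure_mono fun y hy => Or.inl ⟨hy, hne y (hBA hy)⟩)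

theorem rearr_iSup (m : Measure S) {u : ℕ → S → ℝ≥0∞} (hu : Monotone u) (s : ℝ) :
    rearr m (fun x => ⨆ n, u n x) s = ⨆ n, rearr m (u n) s := by
  refine eq_of_forall_ge_iff fun t => ?_
  simp_rw [iSup_le_iff, rearr_le_iff, lt_iSup_iff]
  have hm : Monotone fun n => {x | t < u n x} := fun i j hij x hx => lt_of_lt_of_le hx (hu hij x)
  rw [ofPred_exists, hm.measure_iUnion, iSup_le_iff]

theorem rearr_mono (m : Measure S) {u v : S → ℝ≥0∞} (h : ∀ t, m {x | t < u x} ≤ m {x | t < v x})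
    (s : ℝ) : rearr m u s ≤ rearr m v s :=
  (rearr_le_iff m u s _).2 ((h _).trans ((rearr_le_iff m v s _).1 le_rfl))

/-- A simple function dominates its rearrangement composed with a suitable measure preserving
map to `(0, 1)`. -/
theorem exists_measurePreserving_rearr_le (m : Measure S) [IsProbabilityMeasure m] {v : S → ℝ}
    (hv : Measurable v) (hv0 : ∀ c, m {x | v x = c} = 0) (u : SimpleFunc S ℝ≥0∞) :
    ∃ σ : S → ℝ, MeasurePreserving σ m leb ∧ ∀ x, rearr m u (σ x) ≤ u x := by
  classical
  set N : ℝ≥0∞ → ℕ := fun c => (u.range.filter (· < c)).card with hN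
  have hNlt : ∀ x y, u x < u y → N (u x) + 1 ≤ N (u y) := fun x y hxy => by
    refine Finset.card_lt_card (Finset.ssubset_iff_of_subset ?_ |>.2 ⟨u x, ?_, ?_⟩)
    · intro c hc
      simp only [Finset.mem_filter] at hc ⊢
      exact ⟨hc.1, hc.2.trans hxy⟩
    · simp [hxy]
    · simp
  -- The integer part orders points by the value of `u`; the fractional part, below `1`, breaks ties
  -- through `v`. So `L` has null level sets and refines the order of `u`, and its rank is the
  -- required map.
  set L : S → ℝ≥0∞ := fun x => (N (u x) : ℝ≥0∞) + ENNReal.ofReal (Real.sigmoid (v x)) with hL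
  have hLm : Measurable L := by
    have h1 : Measurable fun x => (N (u x) : ℝ≥0∞) :=
      (u.map fun c => (N c : ℝ≥0∞)).measurable
    have h2 : Measurable Real.sigmoid := Real.sigmoid_monotone.measurable
    exact h1.add (h2.comp hv).ennreal_ofReal
  have hL0 : ∀ c, m {x | L x = c} = 0 := fun c => by
    have hsub : {x | L x = c} ⊆ ⋃ k : ℕ, {x | N (u x) = k ∧ L x = c} := fun x hx =>
      mem_iUnion.2 ⟨N (u x), rfl, hx⟩
    refine measure_mono_null hsub (measure_iUnion_null fun k => ?_)
    by_cases hne : ∃ y, N (u y) = k ∧ L y = c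
    · obtain ⟨y, hy, hyc⟩ := hne
      refine measure_mono_null (fun x hx => ?_) (hv0 (v y))
      have : L x = L y := hx.2.trans hyc.symm
      simp only [hL, hx.1, hy] at this
      rw [ENNReal.add_right_inj (ENNReal.natCast_ne_top k),
        ENNReal.ofReal_eq_ofReal_iff (Real.sigmoid_nonneg _) (Real.sigmoid_nonneg _)] at this
      exact Real.sigmoid_injective this
    · convert measure_empty (μ := m)
      ext x
      simpa using fun h1 h2 => hne ⟨x, h1, h2⟩
  refine ⟨rank m L, measurePreserving_rank m hLm hL0, fun x => ?_⟩
  rw [rearr_le_iff, rank, ENNReal.ofReal_toReal (measure_ne_top _ _)]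
  refine measure_mono fun y hy => ?_
  have h1 : (N (u x) : ℝ≥0∞) + 1 ≤ N (u y) := by exact_mod_cast hNlt x y hy
  have h2 : ENNReal.ofReal (Real.sigmoid (v x)) < 1 := by
    simpa using Real.sigmoid_lt_one (v x)
  calc L x < (N (u x) : ℝ≥0∞) + 1 := ENNReal.add_lt_add_left (ENNReal.natCast_ne_top _) h2
    _ ≤ L y := h1.trans le_self_add

/-- For a simple `a ≤ u`, some measure preserving `σ` has `a* ∘ σ ≤ a`, so `∫ a* q = ∫ (a* ∘ σ)(q ∘
σ) ≤ ∫ u (q ∘ σ)`. Monotone convergence passes to `u`. Thus a pairing with `u*` is controlled by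
pairings of `u` itself with rearranged copies of `q`. -/
theorem lintegral_rearr_mul_le (m : Measure S) [IsProbabilityMeasure m] {v : S → ℝ}
    (hv : Measurable v) (hv0 : ∀ c, m {x | v x = c} = 0) {u : S → ℝ≥0∞} (hu : Measurable u)
    {q : ℝ → ℝ≥0∞} (hq : Measurable q) {B : ℝ≥0∞}
    (h : ∀ σ, MeasurePreserving σ m leb → ∫⁻ x, u x * q (σ x) ∂m ≤ B) :
    ∫⁻ s, rearr m u s * q s ∂leb ≤ B := by
  set a : ℕ → SimpleFunc S ℝ≥0∞ := SimpleFunc.eapprox u with ha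
  have hmono : Monotone fun n => (a n : S → ℝ≥0∞) := fun i j hij =>
    SimpleFunc.monotone_eapprox u hij
  have hsup : u = fun x => ⨆ n, a n x := funext fun x => (SimpleFunc.iSup_eapprox_apply hu x).symm
  have : ∀ s, rearr m u s * q s = ⨆ n, rearr m (a n) s * q s := fun s => by
    rw [← ENNReal.iSup_mul, ← rearr_iSup m hmono s, ← hsup]
  simp_rw [this]
  rw [lintegral_iSup (f := fun n s => rearr m (a n) s * q s)
    (fun n => (measurable_rearr m _).mul hq)]
  · refine iSup_le fun n => ?_
    obtain ⟨σ, hσ, hle⟩ := exists_measurePreserving_rearr_le m hv hv0 (a n)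
    rw [← hσ.lintegral_comp (f := fun s => rearr m (a n) s * q s) ((measurable_rearr m _).mul hq)]
    refine le_trans (lintegral_mono fun x => ?_) (h σ hσ)
    have h1 : a n x ≤ u x := by
      rw [hsup]
      exact le_iSup (fun n => a n x) n
    exact mul_le_mul_left ((hle x).trans h1) _
  · intro i j hij s
    exact mul_le_mul_left (rearr_mono m (fun t => measure_mono fun x hx =>
      lt_of_lt_of_le hx (hmono hij x)) s) _

theorem volume_restrict_Ioi_setOf_ofReal_lt (c : ℝ≥0∞) :
    volume.restrict (Ioi (0 : ℝ)) {s | ENNReal.ofReal s < c} = c := by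
  rw [Measure.restrict_apply' measurableSet_Ioi]
  rcases eq_or_ne c ∞ with rfl | hc
  · simp
  · have : {s : ℝ | ENNReal.ofReal s < c} ∩ Ioi 0 = Ioo 0 c.toReal := by
      ext s
      simp only [mem_inter_iff, mem_ofPred_eq, mem_Ioi, mem_Ioo, and_comm (b := 0 < s)]
      exact and_congr_right fun hs => ENNReal.ofReal_lt_iff_lt_toReal hs.le hc
    rw [this, Real.volume_Ioo, sub_zero, ENNReal.ofReal_toReal hc]

theorem lintegral_eq_lintegral_measure_ofReal_lt (m : Measure S) [SFinite m] {a : S → ℝ≥0∞}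
    (ha : Measurable a) :
    ∫⁻ x, a x ∂m = ∫⁻ s in Ioi (0 : ℝ), m {x | ENNReal.ofReal s < a x} := by
  have hmeas : MeasurableSet {p : S × ℝ | ENNReal.ofReal p.2 < a p.1} :=
    measurableSet_lt (by fun_prop) (by fun_prop)
  calc ∫⁻ x, a x ∂m = ∫⁻ x, volume.restrict (Ioi (0 : ℝ)) {s | ENNReal.ofReal s < a x} ∂m := by
        simp_rw [volume_restrict_Ioi_setOf_ofReal_lt]
    _ = m.prod (volume.restrict (Ioi (0 : ℝ))) {p : S × ℝ | ENNReal.ofReal p.2 < a p.1} :=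
        (Measure.prod_apply hmeas).symm
    _ = _ := Measure.prod_apply_symm hmeas

theorem lintegral_mul_eq_lintegral_lintegral (m : Measure S) [SFinite m] {a b : S → ℝ≥0∞}
    (ha : Measurable a) (hb : Measurable b) :
    ∫⁻ x, a x * b x ∂m = ∫⁻ s in Ioi (0 : ℝ), ∫⁻ t in Ioi (0 : ℝ),
      m ({x | ENNReal.ofReal t < b x} ∩ {x | ENNReal.ofReal s < a x}) := by
  have h1 : ∫⁻ x, a x * b x ∂m = ∫⁻ x, a x ∂(m.withDensity b) := by
    rw [lintegral_withDensity_eq_lintegral_mul _ hb ha]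
    exact lintegral_congr fun x => mul_comm _ _
  rw [h1, lintegral_eq_lintegral_measure_ofReal_lt _ ha]
  refine lintegral_congr fun s => ?_
  have hs : MeasurableSet {x | ENNReal.ofReal s < a x} := measurableSet_lt measurable_const ha
  rw [withDensity_apply _ hs, lintegral_eq_lintegral_measure_ofReal_lt _ hb]
  refine lintegral_congr fun t => ?_
  rw [Measure.restrict_apply (measurableSet_lt measurable_const hb)]

/-- The Hardy–Littlewood inequality. -/
theorem lintegral_mul_le_lintegral_rearr_mul_rearr (m : Measure S) [IsProbabilityMeasure m]
    {a b : S → ℝ≥0∞} (ha : Measurable a) (hb : Measurable b) :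
    ∫⁻ x, a x * b x ∂m ≤ ∫⁻ s, rearr m a s * rearr m b s ∂leb := by
  rw [lintegral_mul_eq_lintegral_lintegral m ha hb, lintegral_mul_eq_lintegral_lintegral leb
    (measurable_rearr m a) (measurable_rearr m b)]
  refine lintegral_mono fun s => lintegral_mono fun t => ?_
  -- In the layer-cake formula, superlevel sets of rearrangements are nested initial intervals, so
  -- their intersection has the largest measure possible: the minimum of the two.
  have : {r | ENNReal.ofReal t < rearr m b r} ∩ {r | ENNReal.ofReal s < rearr m a r} =
      {r | ENNReal.ofReal r <
        min (m {x | ENNReal.ofReal t < b x}) (m {x | ENNReal.ofReal s < a x})} := by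
    ext r
    simp [lt_rearr_iff]
  rw [this, leb_setOf_ofReal_lt _ ((min_le_left _ _).trans prob_le_one)]
  exact le_min (measure_mono inter_subset_left) (measure_mono inter_subset_right)

variable {μ : Measure S} [IsProbabilityMeasure μ]

theorem RISpace.lintegral_mul_le_norm (X : RISpace μ) {u w : S → ℝ≥0∞} (hu : AEMeasurable u μ)
    (hw : X.assocNorm w ≤ 1) : ∫⁻ x, u x * w x ∂μ ≤ X.norm u := by
  rcases eq_or_ne (X.norm u) ∞ with htop | htop
  · simp [htop]
  rcases eq_or_ne (X.norm u) 0 with h0 | h0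
  · have hu0 := (X.norm_eq_zero u hu).1 h0
    rw [lintegral_congr_ae (g := 0) (by filter_upwards [hu0] with x hx; simp [hx])]
    simp
  set c : ℝ≥0 := (X.norm u).toNNReal with hc
  have hcu : (c : ℝ≥0∞) = X.norm u := ENNReal.coe_toNNReal htop
  have hc0 : c ≠ 0 := fun h => h0 (by rw [← hcu, h]; rfl)
  have hn : X.norm (fun x => (c⁻¹ : ℝ≥0) * u x) ≤ 1 := by
    rw [X.norm_smul _ _ hu, ← hcu, ← ENNReal.coe_mul, inv_mul_cancel₀ hc0]
    rfl
  have h1 : ∫⁻ x, (c⁻¹ : ℝ≥0) * u x * w x ∂μ ≤ 1 := by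
    refine le_trans ?_ hw
    exact le_iSup_of_le (fun x => (c⁻¹ : ℝ≥0) * u x)
      (le_iSup_of_le (hu.const_mul _) (le_iSup_of_le hn le_rfl))
  calc ∫⁻ x, u x * w x ∂μ = ∫⁻ x, c * ((c⁻¹ : ℝ≥0) * u x * w x) ∂μ := by
        refine lintegral_congr fun x => ?_
        rw [mul_assoc, ← mul_assoc, ← ENNReal.coe_mul, mul_inv_cancel₀ hc0]
        simp
    _ = c * ∫⁻ x, (c⁻¹ : ℝ≥0) * u x * w x ∂μ := lintegral_const_mul' _ _ ENNReal.coe_ne_top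
    _ ≤ c * 1 := by gcongr
    _ = X.norm u := by rw [mul_one, hcu]

/-- Hölder's inequality for the rearrangements. -/
theorem RISpace.lintegral_rearr_mul_rearr_le_norm (X : RISpace μ) {v : S → ℝ}
    (hv : Measurable v) (hv0 : ∀ c, μ {x | v x = c} = 0) {u w : S → ℝ≥0∞} (hu : Measurable u)
    (hwm : Measurable w) (hw : X.assocNorm w ≤ 1) :
    ∫⁻ s, rearr μ u s * rearr μ w s ∂leb ≤ X.norm u := by
  -- The factor to be un-rearranged is `w`: then `u* ∘ σ` is equimeasurable with `u` and has the
  -- same norm.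
  simp_rw [mul_comm (rearr μ u _)]
  refine lintegral_rearr_mul_le μ hv hv0 hwm (measurable_rearr μ u) fun σ hσ => ?_
  have hm : Measurable (rearr μ u ∘ σ) := (measurable_rearr μ u).comp hσ.measurable
  calc ∫⁻ x, w x * rearr μ u (σ x) ∂μ = ∫⁻ x, (rearr μ u ∘ σ) x * w x ∂μ :=
        lintegral_congr fun x => mul_comm _ _
    _ ≤ X.norm (rearr μ u ∘ σ) := X.lintegral_mul_le_norm hm.aemeasurable hw
    _ = X.norm u := X.norm_congr _ _ hm.aemeasurable hu.aemeasurable fun s _ => by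
        rw [rearr_comp_measurePreserving hσ]

theorem RISpace.assocNorm_congr_ae (X : RISpace μ) {w w' : S → ℝ≥0∞} (h : w =ᵐ[μ] w') :
    X.assocNorm w = X.assocNorm w' := by
  refine iSup_congr fun u => iSup_congr fun _ => iSup_congr fun _ => lintegral_congr_ae ?_
  filter_upwards [h] with x hx
  rw [hx]

end Transport

/-! ### Comparison of measures on the line through half-open intervals -/

theorem measure_le_of_Ioc_le_of_isProbabilityMeasure (ν₁ ν₂ : Measure ℝ) [IsProbabilityMeasure ν₂]
    (h : ∀ a b, a < b → ν₁ (Ioc a b) ≤ ν₂ (Ioc a b)) : ν₁ ≤ ν₂ := by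
  set G := ProbabilityTheory.cdf ν₂ with hG
  have hGm : G.measure = ν₂ := ProbabilityTheory.measure_cdf ν₂
  -- The Stieltjes outer measure of the cdf is the largest outer measure below its length function,
  -- so intervals suffice.
  have houter : ν₁.toOuterMeasure ≤ G.outer := by
    refine OuterMeasure.le_ofFunction.2 fun s => ?_
    rw [StieltjesFunction.length_eq]
    refine le_iInf₂ fun a b => le_iInf fun hs => ?_
    have hs' : s ⊆ Ioc a b := by
      refine fun x hx => hs ⟨hx, fun hbot => ?_⟩
      exact absurd (hbot (x - 1)) (by simp)
    rcases lt_or_ge a b with hab | hab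
    · rw [← StieltjesFunction.measure_Ioc, hGm]
      exact (measure_mono hs').trans (h a b hab)
    · rw [Ioc_eq_empty hab.not_gt, subset_empty_iff] at hs'
      simp [hs']
  rw [← hGm, StieltjesFunction.measure]
  exact Measure.le_intro fun s _ _ => houter s

theorem measure_le_of_Ioc_le (ν₁ ν₂ : Measure ℝ) [IsFiniteMeasure ν₂]
    (h : ∀ a b, a < b → ν₁ (Ioc a b) ≤ ν₂ (Ioc a b)) : ν₁ ≤ ν₂ := by
  rcases eq_or_ne ν₂ 0 with rfl | h0
  · have hU : (univ : Set ℝ) = ⋃ n : ℕ, Ioc (-(n : ℝ) - 1) (n + 1) := by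
      refine (eq_univ_of_forall fun x => ?_).symm
      obtain ⟨n, hn⟩ := exists_nat_gt |x|
      exact mem_iUnion.2 ⟨n, by linarith [neg_abs_le x], by linarith [le_abs_self x]⟩
    have : ν₁ univ = 0 := by
      rw [hU]
      refine measure_iUnion_null fun n => ?_
      have := h (-(n : ℝ) - 1) (n + 1) (by linarith [n.cast_nonneg (α := ℝ)])
      simpa using this
    rw [Measure.measure_univ_eq_zero.1 this]
  · have : NeZero ν₂ := ⟨h0⟩
    have hc : (ν₂ univ)⁻¹ ≠ ∞ := by simpa using h0
    have hc0 : (ν₂ univ) ≠ 0 := by simpa using h0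
    have hle := measure_le_of_Ioc_le_of_isProbabilityMeasure ((ν₂ univ)⁻¹ • ν₁)
      ((ν₂ univ)⁻¹ • ν₂) fun a b hab => by
        simpa using mul_le_mul_right (h a b hab) _
    refine Measure.le_iff.2 fun s hs => ?_
    have := mul_le_mul_right (hle s) (ν₂ univ)
    simpa [← mul_assoc, ENNReal.mul_inv_cancel hc0 (measure_ne_top ν₂ univ)] using this

/-! ### The coarea inequality with the isoperimetric estimator -/

section Coarea

variable {Ω : Type*} [MetricSpace Ω]

/-- The supremum of the difference quotients of `f` at `x` over the punctured ball of radius `h`. -/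
noncomputable def supSlope (f : Ω → ℝ) (h : ℝ) (x : Ω) : ℝ≥0∞ :=
  ⨆ y ∈ Metric.ball x h ∩ {x}ᶜ, ENNReal.ofReal |f x - f y| / edist x y

theorem gradMod_eq_iInf_supSlope (f : Ω → ℝ) (x : Ω) :
    gradMod f x = ⨅ n : ℕ, supSlope f (1 / (n + 1)) x := by
  rw [gradMod, (nhdsWithin_hasBasis Metric.nhds_basis_ball_inv_nat_succ
    {x}ᶜ).limsup_eq_iInf_iSup]
  simp [supSlope]

theorem supSlope_mono (f : Ω → ℝ) {h h' : ℝ} (hh : h ≤ h') (x : Ω) :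
    supSlope f h x ≤ supSlope f h' x :=
  biSup_mono fun _ hy => ⟨Metric.ball_subset_ball hh hy.1, hy.2⟩

theorem antitone_supSlope_inv (f : Ω → ℝ) :
    Antitone fun (n : ℕ) => supSlope f (1 / (n + 1)) := fun i j hij x =>
  supSlope_mono f (one_div_le_one_div_of_le (by positivity) (by gcongr)) x

theorem supSlope_le {f : Ω → ℝ} {L : ℝ≥0} (hf : LipschitzWith L f) (h : ℝ) (x : Ω) :
    supSlope f h x ≤ L := by
  refine iSup₂_le fun y _ => ENNReal.div_le_of_le_mul ?_
  rw [← Real.dist_eq, ← edist_dist]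
  exact hf x y

theorem gradMod_le {f : Ω → ℝ} {L : ℝ≥0} (hf : LipschitzWith L f) (x : Ω) :
    gradMod f x ≤ L := by
  rw [gradMod_eq_iInf_supSlope]
  exact (iInf_le _ 0).trans (supSlope_le hf _ x)

theorem gradMod_mono {f g : Ω → ℝ} {x : Ω} (h : ∀ y, |f x - f y| ≤ |g x - g y|) :
    gradMod f x ≤ gradMod g x :=
  limsup_le_limsup (Eventually.of_forall fun y =>
    ENNReal.div_le_div_right (ENNReal.ofReal_le_ofReal (h y)) _)

theorem gradMod_eq_zero_of_eventually {f : Ω → ℝ} {x : Ω} (h : ∀ᶠ y in 𝓝 x, f y = f x) :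
    gradMod f x = 0 := by
  refine le_antisymm (limsup_le_of_le ?_ ?_) bot_le
  · isBoundedDefault
  · filter_upwards [nhdsWithin_le_nhds h] with y hy
    simp [hy]

theorem supSlope_mul_ge {f : Ω → ℝ} {h : ℝ} {x y : Ω} (hxy : dist y x < h) :
    ENNReal.ofReal (f y - f x) ≤ ENNReal.ofReal h * supSlope f h x := by
  rcases eq_or_ne y x with rfl | hne
  · simp
  have h0 : edist x y ≠ 0 := by simpa using hne.symm
  have h1 : ENNReal.ofReal |f x - f y| / edist x y ≤ supSlope f h x :=
    le_iSup₂ (f := fun y (_ : y ∈ Metric.ball x h ∩ {x}ᶜ) =>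
      ENNReal.ofReal |f x - f y| / edist x y) y ⟨hxy, hne⟩
  calc ENNReal.ofReal (f y - f x) ≤ ENNReal.ofReal |f x - f y| :=
        ENNReal.ofReal_le_ofReal (by rw [abs_sub_comm]; exact le_abs_self _)
    _ = edist x y * (ENNReal.ofReal |f x - f y| / edist x y) :=
        (ENNReal.mul_div_cancel h0 (edist_ne_top x y)).symm
    _ ≤ ENNReal.ofReal h * supSlope f h x := by
        gcongr
        rw [edist_dist, dist_comm]
        exact ENNReal.ofReal_le_ofReal hxy.le

theorem isFiniteMeasure_withDensity_gradMod [MeasurableSpace Ω] (μ : Measure Ω) [IsProbabilityMeasure μ] {f : Ω → ℝ}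
    {L : ℝ≥0} (hf : LipschitzWith L f) : IsFiniteMeasure (μ.withDensity (gradMod f)) :=
  isFiniteMeasure_withDensity <| ((lintegral_mono (gradMod_le hf)).trans_lt (by simp)).ne

variable [MeasurableSpace Ω] [BorelSpace Ω]

/-- This function is lower semicontinuous: for each fixed competitor `y`, the condition that `y`
witnesses a slope above `a` is open in `x`. -/
theorem measurable_supSlope {f : Ω → ℝ} (hf : Continuous f) (h : ℝ) :
    Measurable (supSlope f h) := by
  refine measurable_of_Ioi fun a => IsOpen.measurableSet ?_
  have : supSlope f h ⁻¹' Ioi a =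
      ⋃ y, {x | x ≠ y ∧ dist y x < h} ∩ {x | a < ENNReal.ofReal |f x - f y| / edist x y} := by
    ext x
    simp only [supSlope, mem_preimage, mem_Ioi, lt_iSup_iff, mem_iUnion, mem_inter_iff,
      Metric.mem_ball, mem_compl_iff, mem_singleton_iff, mem_ofPred_eq]
    simp [eq_comm, and_comm, and_left_comm]
  rw [this]
  refine isOpen_iUnion fun y => ?_
  have hU : IsOpen {x | x ≠ y ∧ dist y x < h} :=
    isOpen_compl_singleton.inter (isOpen_lt (continuous_const.dist continuous_id) continuous_const)
  have hc : ContinuousOn (fun x => ENNReal.ofReal |f x - f y| / edist x y)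
      {x | x ≠ y ∧ dist y x < h} := fun x hx => by
    refine ContinuousAt.continuousWithinAt ?_
    refine ENNReal.Tendsto.div ?_ (Or.inr (by simpa using hx.1)) ?_ (Or.inr ENNReal.ofReal_ne_top)
    · exact (ENNReal.continuous_ofReal.comp (hf.sub continuous_const).abs).tendsto x
    · exact (continuous_id.edist continuous_const).tendsto x
  exact hc.isOpen_inter_preimage hU isOpen_Ioi

theorem measurable_gradMod {f : Ω → ℝ} (hf : Continuous f) : Measurable (gradMod f) := by
  simp_rw [funext (gradMod_eq_iInf_supSlope f)]
  exact Measurable.iInf fun n => measurable_supSlope hf _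

/-- A point `x` gained by thickening `{f > s}` satisfies `f x ≤ s < f y` for some `y` within `h`, so
`s - f x` is less than `h` times the slope at `x`. By Tonelli, it remains to measure the levels `s`
allowed for a fixed `x`. -/
theorem lintegral_measure_thickening_sub_le (μ : Measure Ω) [IsProbabilityMeasure μ] {f : Ω → ℝ}
    (hf : Continuous f) (h : ℝ) :
    ∫⁻ s : ℝ, (μ (Metric.thickening h {x | s < f x}) - μ {x | s < f x}) ≤
      ENNReal.ofReal h * ∫⁻ x, supSlope f h x ∂μ := by
  have hS := measurable_supSlope hf h
  have hfm := hf.measurable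
  have hmeas : MeasurableSet
      {p : ℝ × Ω | f p.2 ≤ p.1 ∧ ENNReal.ofReal (p.1 - f p.2) < ENNReal.ofReal h * supSlope f h p.2} :=
    MeasurableSet.inter
      (measurableSet_le (hfm.comp measurable_snd) measurable_fst)
      (measurableSet_lt (measurable_fst.sub (hfm.comp measurable_snd)).ennreal_ofReal
        ((hS.comp measurable_snd).const_mul _))
  have hslice : ∀ (c : ℝ) (b : ℝ≥0∞), volume {s | c ≤ s ∧ ENNReal.ofReal (s - c) < b} ≤ b := by
    intro c b
    rcases eq_or_ne b ∞ with rfl | hb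
    · simp
    have : {s | c ≤ s ∧ ENNReal.ofReal (s - c) < b} ⊆ Ico c (c + b.toReal) := fun s hs =>
      ⟨hs.1, by
        have := (ENNReal.ofReal_lt_iff_lt_toReal (sub_nonneg.2 hs.1) hb).1 hs.2
        linarith⟩
    refine (measure_mono this).trans ?_
    rw [Real.volume_Ico, add_sub_cancel_left, ENNReal.ofReal_toReal hb]
  calc ∫⁻ s : ℝ, (μ (Metric.thickening h {x | s < f x}) - μ {x | s < f x})
      ≤ ∫⁻ s : ℝ, μ {x | f x ≤ s ∧ ENNReal.ofReal (s - f x) < ENNReal.ofReal h * supSlope f h x} := by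
        refine lintegral_mono fun s => ?_
        refine le_measure_sdiff.trans (measure_mono fun x hx => ?_)
        obtain ⟨hx1, hx2⟩ := hx
        obtain ⟨y, hy, hxy⟩ := Metric.mem_thickening_iff.1 hx1
        have hle : f x ≤ s := not_lt.1 hx2
        refine ⟨hle, lt_of_lt_of_le ?_ (supSlope_mul_ge (f := f) (by rwa [dist_comm] at hxy))⟩
        have hy' : s < f y := hy
        rw [ENNReal.ofReal_lt_ofReal_iff (by linarith)]
        linarith
    _ = (volume.prod μ) {p : ℝ × Ω | f p.2 ≤ p.1 ∧
          ENNReal.ofReal (p.1 - f p.2) < ENNReal.ofReal h * supSlope f h p.2} :=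
        (Measure.prod_apply hmeas).symm
    _ = ∫⁻ x, volume {s | f x ≤ s ∧ ENNReal.ofReal (s - f x) < ENNReal.ofReal h * supSlope f h x} ∂μ :=
        Measure.prod_apply_symm hmeas
    _ ≤ ∫⁻ x, ENNReal.ofReal h * supSlope f h x ∂μ := lintegral_mono fun x => hslice _ _
    _ = _ := lintegral_const_mul _ hS

/-- The coarea inequality combined with an isoperimetric inequality. -/
theorem lintegral_isoperimetric_le_lintegral_gradMod (μ : Measure Ω) [IsProbabilityMeasure μ]
    {J : ℝ → ℝ≥0∞} (hJ : ∀ t ∈ Icc (0 : ℝ) 1, J t ≤ isoProfile μ t) {f : Ω → ℝ} {L : ℝ≥0}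
    (hf : LipschitzWith L f) :
    ∫⁻ s : ℝ, J (μ {x | s < f x}).toReal ≤ ∫⁻ x, gradMod f x ∂μ := by
  have hc := hf.continuous
  set F : ℕ → ℝ → ℝ≥0∞ := fun n s =>
    (μ (Metric.thickening (1 / ((n : ℝ) + 1)) {x | s < f x}) - μ {x | s < f x}) /
      ENNReal.ofReal (1 / ((n : ℝ) + 1)) with hF
  have hFm : ∀ n, Measurable (F n) := fun n => by
    refine Measurable.div (Measurable.sub ?_ ?_) measurable_const
    · exact Antitone.measurable fun s t hst => measure_mono
        (Metric.thickening_subset_of_subset _ fun x hx => lt_of_le_of_lt hst hx)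
    · exact Antitone.measurable fun s t hst => measure_mono fun x hx => lt_of_le_of_lt hst hx
  have hpt : ∀ s, J (μ {x | s < f x}).toReal ≤ liminf (fun n => F n s) atTop := fun s => by
    have hA : MeasurableSet {x | s < f x} := measurableSet_lt measurable_const hc.measurable
    calc J (μ {x | s < f x}).toReal ≤ isoProfile μ (μ {x | s < f x}).toReal :=
          hJ _ ⟨ENNReal.toReal_nonneg, measureReal_le_one⟩
      _ ≤ perimeter μ {x | s < f x} :=
          iInf_le_of_le _ (iInf_le_of_le hA (iInf_le_of_le
            (ENNReal.ofReal_toReal (measure_ne_top _ _)).symm le_rfl))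
      _ ≤ liminf (fun n => F n s) atTop := by
          have ht : Tendsto (fun n : ℕ => 1 / ((n : ℝ) + 1)) atTop (𝓝[>] 0) :=
            tendsto_nhdsWithin_iff.2 ⟨tendsto_one_div_add_atTop_nhds_zero_nat,
              Eventually.of_forall fun n => by simp only [mem_Ioi]; positivity⟩
          exact liminf_le_liminf_of_le (g := map (fun n : ℕ => 1 / ((n : ℝ) + 1)) atTop) ht
            (by isBoundedDefault) (by isBoundedDefault)
  have hint : ∀ n, ∫⁻ s, F n s ≤ ∫⁻ x, supSlope f (1 / ((n : ℝ) + 1)) x ∂μ := fun n => by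
    have hpos : ENNReal.ofReal (1 / ((n : ℝ) + 1)) ≠ 0 := by
      simpa using (by positivity : (0 : ℝ) < (n : ℝ) + 1)
    simp only [hF, div_eq_mul_inv]
    rw [lintegral_mul_const' _ _ (ENNReal.inv_ne_top.2 (by simpa [div_eq_mul_inv] using hpos)),
      ← div_eq_mul_inv]
    refine ENNReal.div_le_of_le_mul' ?_
    exact lintegral_measure_thickening_sub_le μ hc _
  -- Fatou takes the limit outside. The slopes decrease to the gradient and are bounded by `L`, so
  -- their integrals converge.
  calc ∫⁻ s : ℝ, J (μ {x | s < f x}).toReal ≤ ∫⁻ s : ℝ, liminf (fun n => F n s) atTop :=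
        lintegral_mono hpt
    _ ≤ liminf (fun n => ∫⁻ s, F n s) atTop := lintegral_liminf_le hFm
    _ ≤ liminf (fun n : ℕ => ∫⁻ x, supSlope f (1 / ((n : ℝ) + 1)) x ∂μ) atTop :=
        liminf_le_liminf (Eventually.of_forall hint)
    _ = ∫⁻ x, gradMod f x ∂μ := by
        refine Tendsto.liminf_eq ?_
        simp_rw [gradMod_eq_iInf_supSlope]
        rw [lintegral_iInf (fun n => measurable_supSlope hc _) (antitone_supSlope_inv f)]
        · exact tendsto_atTop_iInf fun i j hij => lintegral_mono (antitone_supSlope_inv f hij)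
        · refine ((lintegral_mono (supSlope_le hf _)).trans_lt ?_).ne
          simp

/-- Truncating `f` to `[a, b]` keeps the superlevel sets for levels inside `(a, b)` and kills the
gradient where `f` is outside `[a, b]`. The band stays closed since the truncation may have slope
where `f` equals an endpoint. -/
theorem setLIntegral_isoperimetric_le (μ : Measure Ω) [IsProbabilityMeasure μ]
    {J : ℝ → ℝ≥0∞} (hJ : ∀ t ∈ Icc (0 : ℝ) 1, J t ≤ isoProfile μ t) {f : Ω → ℝ} {L : ℝ≥0}
    (hf : LipschitzWith L f) (a b : ℝ) :
    ∫⁻ s in Ioc a b, J (μ {x | s < f x}).toReal ≤ ∫⁻ x in f ⁻¹' Icc a b, gradMod f x ∂μ := by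
  set g : Ω → ℝ := fun x => max a (min (f x) b) with hg
  have hgL : LipschitzWith L g := (hf.min_const b).const_max a
  have hlevel : ∀ s ∈ Ioo a b, {x | s < g x} = {x | s < f x} := fun s hs => by
    ext x
    simp [hg, hs.1.not_gt, hs.2]
  have hgrad : ∀ x, gradMod g x ≤ (f ⁻¹' Icc a b).indicator (gradMod f) x := fun x => by
    by_cases hx : f x ∈ Icc a b
    · rw [indicator_of_mem (by exact hx)]
      refine gradMod_mono fun y => ?_
      have h1 := abs_max_sub_max_le_abs (min (f x) b) (min (f y) b) a
      have h2 := abs_min_sub_min_le_max (f x) b (f y) b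
      simp only [hg, max_comm a]
      refine h1.trans (h2.trans ?_)
      simp
    · refine (gradMod_eq_zero_of_eventually ?_).le.trans bot_le
      rw [mem_Icc, not_and_or, not_le, not_le] at hx
      rcases hx with hx | hx
      · filter_upwards [hf.continuous.continuousAt.eventually_lt_const hx] with y hy
        simp [hg, hx.le, hy.le]
      · filter_upwards [hf.continuous.continuousAt.eventually_const_lt hx] with y hy
        simp [hg, hx.le, hy.le]
  calc ∫⁻ s in Ioc a b, J (μ {x | s < f x}).toReal
      = ∫⁻ s in Ioo a b, J (μ {x | s < f x}).toReal := by
        rw [Measure.restrict_congr_set Ioo_ae_eq_Ioc]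
    _ = ∫⁻ s in Ioo a b, J (μ {x | s < g x}).toReal :=
        setLIntegral_congr_fun measurableSet_Ioo fun s hs => by simp only [hlevel s hs]
    _ ≤ ∫⁻ s, J (μ {x | s < g x}).toReal := setLIntegral_le_lintegral _ _
    _ ≤ ∫⁻ x, gradMod g x ∂μ := lintegral_isoperimetric_le_lintegral_gradMod μ hJ hgL
    _ ≤ ∫⁻ x, (f ⁻¹' Icc a b).indicator (gradMod f) x ∂μ := lintegral_mono hgrad
    _ = _ := lintegral_indicator (hf.continuous.measurable measurableSet_Icc) _

/-- The coarea inequality as an inequality between measures on the line. -/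
theorem withDensity_isoperimetric_le_map (μ : Measure Ω) [IsProbabilityMeasure μ]
    {J : ℝ → ℝ≥0∞} (hJ : ∀ t ∈ Icc (0 : ℝ) 1, J t ≤ isoProfile μ t) {f : Ω → ℝ} {L : ℝ≥0}
    (hf : LipschitzWith L f) (hgrad : ∀ c : ℝ, ∀ᵐ x ∂μ, f x = c → gradMod f x = 0) :
    volume.withDensity (fun s : ℝ => J (μ {x | s < f x}).toReal) ≤
      (μ.withDensity (gradMod f)).map f := by
  have hfm := hf.continuous.measurable
  have := isFiniteMeasure_withDensity_gradMod μ hf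
  refine measure_le_of_Ioc_le _ _ fun a b _ => ?_
  -- Vanishing of the gradient on level sets removes the endpoint, so the closed band matches the
  -- half-open interval.
  have hatom : (μ.withDensity (gradMod f)).map f {a} = 0 := by
    rw [Measure.map_apply hfm (measurableSet_singleton a),
      withDensity_apply _ (hfm (measurableSet_singleton a)),
      setLIntegral_congr_fun_ae (g := 0) (hfm (measurableSet_singleton a)) (hgrad a)]
    simp
  rw [withDensity_apply _ measurableSet_Ioc, measure_congr (Ioc_ae_eq_Icc' hatom),
    Measure.map_apply hfm measurableSet_Icc, withDensity_apply _ (hfm measurableSet_Icc)]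
  exact setLIntegral_isoperimetric_le μ hJ hf a b

end Coarea


/-! ### The measure `-df*` -/

section LevelMeasure

theorem setOf_lt_eq_setOf_ofReal_lt {Ω : Type*} (f : Ω → ℝ) {s : ℝ} (hs : 0 ≤ s) :
    {x | s < f x} = {x | ENNReal.ofReal s < ENNReal.ofReal (f x)} := by
  ext x
  simp only [mem_ofPred_eq, ENNReal.ofReal_lt_ofReal_iff']
  exact ⟨fun h => ⟨h, hs.trans_lt h⟩, fun h => h.1⟩

variable {Ω : Type*} [MeasurableSpace Ω]

/-- The part in `(0, 1)` of the image of Lebesgue measure under the distribution function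
of `f`. -/
noncomputable def levelMeasure (μ : Measure Ω) (f : Ω → ℝ) : Measure ℝ :=
  (volume.map fun s : ℝ => (μ {x | s < f x}).toReal).restrict (Ioo 0 1)

theorem measurable_distribution (μ : Measure Ω) (f : Ω → ℝ) :
    Measurable fun s : ℝ => (μ {x | s < f x}).toReal := by
  have : Measurable fun s : ℝ => μ {x | s < f x} :=
    Antitone.measurable fun s t hst => measure_mono fun x hx => lt_of_le_of_lt hst hx
  exact this.ennreal_toReal

/-- The levels with distribution value in `(t, 1/2]` are exactly `0 ≤ s < f*(t)`: negative levels
have value `1`, and the support bound keeps all others at most `1/2`. -/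
theorem levelMeasure_Ioc (μ : Measure Ω) [IsProbabilityMeasure μ] {f : Ω → ℝ} (hf0 : ∀ x, 0 ≤ f x)
    (hhalf : μ {x | 0 < f x} ≤ ENNReal.ofReal (1 / 2)) {t : ℝ} (ht : t ∈ Ioo (0 : ℝ) (1 / 2)) :
    levelMeasure μ f (Ioc t (1 / 2)) = rearr μ (fun x => ENNReal.ofReal (f x)) t := by
  have hsub : Ioc t (1 / 2) ⊆ Ioo 0 1 := fun s hs => ⟨ht.1.trans hs.1, hs.2.trans_lt (by norm_num)⟩
  have hset : (fun s : ℝ => (μ {x | s < f x}).toReal) ⁻¹' Ioc t (1 / 2) =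
      {s | ENNReal.ofReal s < rearr μ (fun x => ENNReal.ofReal (f x)) t} ∩ Ici 0 := by
    ext s
    simp only [mem_preimage, mem_inter_iff, mem_ofPred_eq, mem_Ici, lt_rearr_iff]
    rcases lt_or_ge s 0 with hs | hs
    · have : {x | s < f x} = univ := eq_univ_of_forall fun x => hs.trans_le (hf0 x)
      simp only [this, hs.not_ge, and_false, iff_false]
      simp only [measure_univ, ENNReal.toReal_one, mem_Ioc, not_and, not_le]
      norm_num
    · rw [← setOf_lt_eq_setOf_ofReal_lt f hs]
      have hle : (μ {x | s < f x}).toReal ≤ 1 / 2 := by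
        refine ENNReal.toReal_le_of_le_ofReal (by norm_num) (le_trans ?_ hhalf)
        exact measure_mono fun x hx => hs.trans_lt hx
      simp only [mem_Ioc, hle, hs, and_true]
      exact (ENNReal.ofReal_lt_iff_lt_toReal ht.1.le (measure_ne_top _ _)).symm
  rw [levelMeasure, Measure.restrict_apply measurableSet_Ioc, inter_eq_left.2 hsub,
    Measure.map_apply (measurable_distribution μ f) measurableSet_Ioc, hset,
    ← Measure.restrict_apply' measurableSet_Ici, ← Measure.restrict_congr_set Ioi_ae_eq_Ici,
    volume_restrict_Ioi_setOf_ofReal_lt]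

end LevelMeasure

/-! ### The density `h` and its norm -/

section Density

variable {Ω : Type*} [MetricSpace Ω]

/-- Only countably many levels carry positive measure, so the exceptional null sets of `hgrad` can
be united. -/
theorem ae_gradMod_eq_zero_of_notMem_nullLevel [MeasurableSpace Ω] (μ : Measure Ω) [IsProbabilityMeasure μ] {f : Ω → ℝ}
    (hfm : Measurable f) (hf0 : ∀ x, 0 ≤ f x)
    (hgrad : ∀ c : ℝ, ∀ᵐ x ∂μ, f x = c → gradMod f x = 0) :
    ∀ᵐ x ∂μ, x ∉ nullLevel μ (fun x => ENNReal.ofReal (f x)) → gradMod f x = 0 := by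
  have hC := countable_setOf_measure_singleton_ne_zero (μ.map f)
  have := (ae_ball_iff (μ := μ) (p := fun x c _ => f x = c → gradMod f x = 0) hC).2
    fun c _ => hgrad c
  filter_upwards [this] with x hx hxN
  refine hx (f x) (fun h0 => hxN ?_) rfl
  rw [Measure.map_apply hfm (measurableSet_singleton _)] at h0
  rw [nullLevel, mem_ofPred_eq, ← h0]
  congr 1
  ext y
  simp [ENNReal.ofReal_eq_ofReal_iff (hf0 _) (hf0 _)]

variable [MeasurableSpace Ω] [BorelSpace Ω]

/-- The distribution function composed with `f` is the rank. Pushing the coarea inequality forward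
by the distribution function therefore compares `I · (-df*)` with the image of `|∇f| μ` under the
rank. -/
theorem lintegral_withDensity_levelMeasure_le (μ : Measure Ω) [IsProbabilityMeasure μ]
    {J : ℝ → ℝ≥0∞} (hJm : Measurable J) (hJ : ∀ t ∈ Icc (0 : ℝ) 1, J t ≤ isoProfile μ t)
    {f : Ω → ℝ} {L : ℝ≥0} (hf : LipschitzWith L f) (hf0 : ∀ x, 0 ≤ f x)
    (hgrad : ∀ c : ℝ, ∀ᵐ x ∂μ, f x = c → gradMod f x = 0) {φ : ℝ → ℝ≥0∞} (hφ : Measurable φ) :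
    ∫⁻ t, φ t ∂((levelMeasure μ f).withDensity J) ≤
      ∫⁻ x in nullLevel μ (fun x => ENNReal.ofReal (f x)),
        gradMod f x * φ (rank μ (fun x => ENNReal.ofReal (f x)) x) ∂μ := by
  set u : Ω → ℝ≥0∞ := fun x => ENNReal.ofReal (f x) with hu
  have hfm := hf.continuous.measurable
  have hum : Measurable u := hfm.ennreal_ofReal
  have hGm := measurable_gradMod hf.continuous
  have hD := measurable_distribution μ f
  have hrank : ∀ x, rank μ u x = (μ {y | f x < f y}).toReal := fun x => by
    rw [setOf_lt_eq_setOf_ofReal_lt f (hf0 x)]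
    rfl
  have hle : (levelMeasure μ f).withDensity J ≤ (μ.withDensity (gradMod f)).map (rank μ u) := by
    refine Measure.le_iff.2 fun E hE => ?_
    have hE' : MeasurableSet (E ∩ Ioo 0 1) := hE.inter measurableSet_Ioo
    calc (levelMeasure μ f).withDensity J E
        = (volume.withDensity fun s : ℝ => J (μ {x | s < f x}).toReal)
            ((fun s : ℝ => (μ {x | s < f x}).toReal) ⁻¹' (E ∩ Ioo 0 1)) := by
          rw [withDensity_apply _ hE, levelMeasure, Measure.restrict_restrict hE,
            setLIntegral_map hE' hJm hD, withDensity_apply _ (hD hE')]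
      _ ≤ (μ.withDensity (gradMod f)).map f
            ((fun s : ℝ => (μ {x | s < f x}).toReal) ⁻¹' (E ∩ Ioo 0 1)) :=
          withDensity_isoperimetric_le_map μ hJ hf hgrad _
      _ ≤ (μ.withDensity (gradMod f)).map (rank μ u) E := by
          rw [Measure.map_apply hfm (hD hE'), Measure.map_apply (measurable_rank μ hum) hE]
          refine measure_mono fun x hx => ?_
          rw [mem_preimage, hrank]
          exact hx.1
  have hN := measurableSet_nullLevel μ hum
  calc ∫⁻ t, φ t ∂((levelMeasure μ f).withDensity J)
      ≤ ∫⁻ t, φ t ∂((μ.withDensity (gradMod f)).map (rank μ u)) := lintegral_mono' hle le_rfl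
    _ = ∫⁻ x, gradMod f x * φ (rank μ u x) ∂μ := by
        rw [lintegral_map hφ (measurable_rank μ hum)]
        exact lintegral_withDensity_eq_lintegral_mul _ hGm (hφ.comp (measurable_rank μ hum))
    _ = ∫⁻ x, (nullLevel μ u).indicator (fun x => gradMod f x * φ (rank μ u x)) x ∂μ := by
        refine lintegral_congr_ae ?_
        filter_upwards [ae_gradMod_eq_zero_of_notMem_nullLevel μ hfm hf0 hgrad] with x hx
        by_cases hxN : x ∈ nullLevel μ u
        · rw [indicator_of_mem hxN]
        · rw [indicator_of_notMem hxN, hx hxN, zero_mul]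
    _ = _ := lintegral_indicator hN _

theorem withDensity_levelMeasure_le (μ : Measure Ω) [IsProbabilityMeasure μ]
    {J : ℝ → ℝ≥0∞} (hJm : Measurable J) (hJ : ∀ t ∈ Icc (0 : ℝ) 1, J t ≤ isoProfile μ t)
    {f : Ω → ℝ} {L : ℝ≥0} (hf : LipschitzWith L f) (hf0 : ∀ x, 0 ≤ f x)
    (hgrad : ∀ c : ℝ, ∀ᵐ x ∂μ, f x = c → gradMod f x = 0) :
    (levelMeasure μ f).withDensity J ≤ (L : ℝ≥0∞) • leb := by
  have hum : Measurable fun x => ENNReal.ofReal (f x) := hf.continuous.measurable.ennreal_ofReal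
  have hrm := measurable_rank μ hum
  refine Measure.le_iff.2 fun E hE => ?_
  have hφ : Measurable (E.indicator (1 : ℝ → ℝ≥0∞)) := measurable_one.indicator hE
  rw [← lintegral_indicator_one hE]
  refine (lintegral_withDensity_levelMeasure_le μ hJm hJ hf hf0 hgrad hφ).trans ?_
  refine (lintegral_mono fun x => mul_le_mul_left (gradMod_le hf x) _).trans ?_
  rw [lintegral_const_mul' _ _ ENNReal.coe_ne_top, ← lintegral_map hφ hrm, lintegral_indicator_one hE,
    Measure.smul_apply, smul_eq_mul]
  gcongr
  exact map_rank_restrict_le μ hum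

/-- The rearrangement of a nonnegative Lipschitz function with support of measure at most `1/2` is
the image under the isoperimetric Hardy operator of a function dominated by the gradient. -/
theorem exists_hardyQ_eq_rearr (μ : Measure Ω) [IsProbabilityMeasure μ] {v : Ω → ℝ}
    (hv : Measurable v) (hv0 : ∀ c, μ {x | v x = c} = 0) {I : ℝ → ℝ} (hI : IsConvexEstimator μ I)
    {f : Ω → ℝ} {L : ℝ≥0} (hf : LipschitzWith L f) (hf0 : ∀ x, 0 ≤ f x)
    (hhalf : μ {x | 0 < f x} ≤ ENNReal.ofReal (1 / 2))
    (hgrad : ∀ c : ℝ, ∀ᵐ x ∂μ, f x = c → gradMod f x = 0) :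
    ∃ h : ℝ → ℝ, Measurable h ∧
      (∀ t ∈ Ioo (0 : ℝ) (1 / 2),
        hardyQ I h t = (rearr μ (fun x => ENNReal.ofReal (f x)) t).toReal) ∧
      ∀ X : RISpace μ, X.barNorm h ≤ X.norm (gradMod f) := by
  set u : Ω → ℝ≥0∞ := fun x => ENNReal.ofReal (f x) with hu
  have hum : Measurable u := hf.continuous.measurable.ennreal_ofReal
  have hGm := measurable_gradMod hf.continuous
  have hrm := measurable_rank μ hum
  have hN := measurableSet_nullLevel μ hum
  -- A continuous extension makes `I` measurable on the whole line; values off `[0, 1]` play no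
  -- role.
  set I' : ℝ → ℝ := IccExtend zero_le_one ((Icc (0 : ℝ) 1).domRestrict I) with hI'
  have hI'c : Continuous I' := hI.continuousOn.domRestrict.Icc_extend'
  have hI'eq : ∀ t ∈ Icc (0 : ℝ) 1, I' t = I t := fun t ht => IccExtend_of_mem _ _ ht
  set J : ℝ → ℝ≥0∞ := fun t => ENNReal.ofReal (I' t) with hJdef
  have hJm : Measurable J := hI'c.measurable.ennreal_ofReal
  have hJ : ∀ t ∈ Icc (0 : ℝ) 1, J t ≤ isoProfile μ t := fun t ht => by
    rw [hJdef]
    simp only [hI'eq t ht]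
    exact hI.le_profile t ht
  set η := (levelMeasure μ f).withDensity J with hη
  have hηle : η ≤ (L : ℝ≥0∞) • leb := withDensity_levelMeasure_le μ hJm hJ hf hf0 hgrad
  have hηac : η ≪ leb :=
    (Measure.absolutelyContinuous_of_le hηle).trans Measure.smul_absolutelyContinuous
  have : IsFiniteMeasure ((L : ℝ≥0∞) • leb) := ⟨by
    rw [Measure.smul_apply, measure_univ]
    simp⟩
  have : IsFiniteMeasure η := isFiniteMeasure_of_le _ hηle
  -- This is the rigorous form of `I · (-f*)'`; dividing by `I` and integrating over `(t, 1/2]`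
  -- recovers `f*(t)`.
  set k := η.rnDeriv leb with hk
  have hkm : Measurable k := Measure.measurable_rnDeriv _ _
  have hkη : leb.withDensity k = η := Measure.withDensity_rnDeriv_eq _ _ hηac
  have hkfin : ∀ᵐ t ∂leb, k t < ∞ := Measure.rnDeriv_lt_top _ _
  refine ⟨fun t => (k t).toReal, hkm.ennreal_toReal, fun t ht => ?_, fun X => ?_⟩
  · have hsub : Ioc t (1 / 2) ⊆ Ioo 0 1 := fun s hs =>
      ⟨ht.1.trans hs.1, hs.2.trans_lt (by norm_num)⟩
    have hpos : ∀ s ∈ Ioc t (1 / 2), 0 < I' s := fun s hs => by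
      rw [hI'eq s (Ioo_subset_Icc_self (hsub hs))]
      exact hI.pos s (hsub hs)
    have hmeas : (volume : Measure ℝ).restrict (Ioc t (1 / 2)) = leb.restrict (Ioc t (1 / 2)) :=
      (Measure.restrict_restrict_of_subset hsub).symm
    have hkI : Measurable fun s => (k s).toReal / I' s :=
      hkm.ennreal_toReal.div hI'c.measurable
    rw [hardyQ, indicator_of_mem ht, intervalIntegral.integral_of_le ht.2.le]
    rw [setIntegral_congr_fun (g := fun s => (k s).toReal / I' s) measurableSet_Ioc
      fun s hs => by simp only [hI'eq s (Ioo_subset_Icc_self (hsub hs))]]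
    rw [integral_eq_lintegral_of_nonneg_ae ?_ hkI.aestronglyMeasurable]
    · congr 1
      calc ∫⁻ s in Ioc t (1 / 2), ENNReal.ofReal ((k s).toReal / I' s)
          = ∫⁻ s in Ioc t (1 / 2), k s * (J s)⁻¹ ∂leb := by
            rw [hmeas]
            refine lintegral_congr_ae ?_
            filter_upwards [ae_restrict_of_ae hkfin, ae_restrict_mem measurableSet_Ioc] with s hs hs'
            rw [ENNReal.ofReal_div_of_pos (hpos s hs'), ENNReal.ofReal_toReal hs.ne, div_eq_mul_inv]
        _ = ∫⁻ s in Ioc t (1 / 2), (J s)⁻¹ ∂η := by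
            rw [← hkη]
            exact (setLIntegral_withDensity_eq_setLIntegral_mul _ hkm hJm.inv
              measurableSet_Ioc).symm
        _ = ∫⁻ s in Ioc t (1 / 2), J s * (J s)⁻¹ ∂(levelMeasure μ f) :=
            setLIntegral_withDensity_eq_setLIntegral_mul _ hJm hJm.inv measurableSet_Ioc
        _ = ∫⁻ s in Ioc t (1 / 2), 1 ∂(levelMeasure μ f) :=
            setLIntegral_congr_fun measurableSet_Ioc fun s hs =>
              ENNReal.mul_inv_cancel (by simpa [hJdef] using hpos s hs) ENNReal.ofReal_ne_top
        _ = rearr μ u t := by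
            rw [setLIntegral_one, levelMeasure_Ioc μ hf0 hhalf ht]
    · filter_upwards [ae_restrict_mem measurableSet_Ioc] with s hs
      exact div_nonneg ENNReal.toReal_nonneg (hpos s hs).le
  · refine iSup_le fun w₀ => iSup_le fun hw₀m => iSup_le fun hw₀ => ?_
    obtain ⟨w, hwm, hw₀w⟩ := hw₀m
    have hw : X.assocNorm w ≤ 1 := by rwa [← X.assocNorm_congr_ae hw₀w]
    have hkr : rearr leb (fun t => ENNReal.ofReal |(k t).toReal|) = rearr leb k :=
      rearr_congr_ae <| by
        filter_upwards [hkfin] with t ht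
        rw [abs_of_nonneg ENNReal.toReal_nonneg, ENNReal.ofReal_toReal ht.ne]
    rw [hkr, rearr_congr_ae hw₀w]
    have hq := measurable_rearr μ w
    refine lintegral_rearr_mul_le leb measurable_id (fun c => ?_) hkm hq fun σ hσ => ?_
    · simp
    have hqσ : Measurable fun t => rearr μ w (σ t) := hq.comp hσ.measurable
    -- Cutting off outside the null levels loses nothing, as the gradient vanishes there, and makes
    -- the distribution function of `w'` at most that of `w`.
    set w' : Ω → ℝ≥0∞ := (nullLevel μ u).indicator fun x => rearr μ w (σ (rank μ u x)) with hw'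
    have hw'm : Measurable w' := (hqσ.comp hrm).indicator hN
    have hw'le : ∀ r, μ {x | r < w' x} ≤ μ {x | r < w x} := fun r => by
      have hA : MeasurableSet {t | r < rearr μ w (σ t)} := measurableSet_lt measurable_const hqσ
      calc μ {x | r < w' x} ≤ (μ.restrict (nullLevel μ u)).map (rank μ u)
              {t | r < rearr μ w (σ t)} := by
            rw [Measure.map_apply hrm hA, Measure.restrict_apply (hrm hA)]
            refine measure_mono fun x hx => ?_
            by_cases hxN : x ∈ nullLevel μ u
            · exact ⟨by simpa [hw', hxN] using hx, hxN⟩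
            · simp [hw', hxN] at hx
        _ ≤ leb {t | r < rearr μ w (σ t)} := map_rank_restrict_le μ hum _
        _ = leb {t | r < rearr μ w t} :=
            hσ.measure_preimage (measurableSet_lt measurable_const hq).nullMeasurableSet
        _ = μ {x | r < w x} := leb_setOf_lt_rearr μ w r
    calc ∫⁻ t, k t * rearr μ w (σ t) ∂leb = ∫⁻ t, rearr μ w (σ t) ∂η := by
          rw [← hkη, lintegral_withDensity_eq_lintegral_mul _ hkm hqσ]
          rfl
      _ ≤ ∫⁻ x in nullLevel μ u, gradMod f x * rearr μ w (σ (rank μ u x)) ∂μ :=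
          lintegral_withDensity_levelMeasure_le μ hJm hJ hf hf0 hgrad hqσ
      _ = ∫⁻ x, gradMod f x * w' x ∂μ := by
          rw [← lintegral_indicator hN]
          refine lintegral_congr fun x => ?_
          by_cases hxN : x ∈ nullLevel μ u <;> simp [hw', hxN]
      _ ≤ ∫⁻ s, rearr μ (gradMod f) s * rearr μ w' s ∂leb :=
          lintegral_mul_le_lintegral_rearr_mul_rearr μ hGm hw'm
      _ ≤ ∫⁻ s, rearr μ (gradMod f) s * rearr μ w s ∂leb :=
          lintegral_mono fun s => mul_le_mul_right (rearr_mono μ hw'le s) _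
      _ ≤ X.norm (gradMod f) :=
          X.lintegral_rearr_mul_rearr_le_norm hv hv0 hGm hwm hw

end Density


/-! ### Medians, disjoint supports and reflection -/

section Median

variable {S : Type*} [MeasurableSpace S]

theorem exists_median (μ : Measure S) [IsProbabilityMeasure μ] {g : S → ℝ} (hg : Measurable g) :
    ∃ m : ℝ, μ {x | m < g x} ≤ ENNReal.ofReal (1 / 2) ∧
      μ {x | g x < m} ≤ ENNReal.ofReal (1 / 2) := by
  have := Measure.isProbabilityMeasure_map (μ := μ) hg.aemeasurable
  set ρ := μ.map g with hρ
  set G := ProbabilityTheory.cdf ρ with hG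
  have hreal : ∀ x, G x = ρ.real (Iic x) := ProbabilityTheory.cdf_eq_real ρ
  set T : Set ℝ := {x | 1 / 2 ≤ G x} with hT
  have hne : T.Nonempty :=
    ((ProbabilityTheory.tendsto_cdf_atTop ρ).eventually_const_le (by norm_num)).exists
  have hbdd : BddBelow T := by
    obtain ⟨a, ha⟩ := ((ProbabilityTheory.tendsto_cdf_atBot ρ).eventually_lt_const
      (by norm_num : (0 : ℝ) < 1 / 2)).exists
    refine ⟨a, fun x hx => le_of_not_gt fun hxa => ?_⟩
    exact absurd ((G.mono hxa.le).trans_lt ha) (not_lt.2 hx)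
  -- Right continuity of the cdf gives the bound above this point; approximation from the left,
  -- where the cdf is below `1/2`, gives the other.
  refine ⟨sInf T, ?_, ?_⟩
  · have h1 : 1 / 2 ≤ G (sInf T) := by
      have ht : Tendsto G (𝓝[>] (sInf T)) (𝓝 (G (sInf T))) :=
        (G.right_continuous (sInf T)).mono_left (nhdsWithin_mono _ Ioi_subset_Ici_self)
      refine ge_of_tendsto ht ?_
      filter_upwards [self_mem_nhdsWithin] with x hx
      obtain ⟨y, hy, hyx⟩ := exists_lt_of_csInf_lt hne hx
      exact le_trans hy (G.mono hyx.le)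
    have h2 : μ {x | sInf T < g x} = ρ (Iic (sInf T))ᶜ := by
      rw [compl_Iic, hρ, Measure.map_apply hg measurableSet_Ioi]
      rfl
    rw [h2, ← ENNReal.ofReal_toReal (measure_ne_top ρ _)]
    refine ENNReal.ofReal_le_ofReal ?_
    have h3 := probReal_compl_eq_one_sub (μ := ρ) (measurableSet_Iic (a := sInf T))
    rw [measureReal_def] at h3
    rw [h3, ← hreal]
    linarith
  · have hU : {x | g x < sInf T} = ⋃ n : ℕ, {x | g x ≤ sInf T - 1 / (n + 1)} := by
      ext x
      simp only [mem_ofPred_eq, mem_iUnion]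
      constructor
      · intro hx
        obtain ⟨n, hn⟩ := exists_nat_one_div_lt (sub_pos.2 hx)
        exact ⟨n, by linarith⟩
      · rintro ⟨n, hn⟩
        have : (0 : ℝ) < 1 / (n + 1) := by positivity
        linarith
    have hmono : Monotone fun n : ℕ => {x | g x ≤ sInf T - 1 / ((n : ℝ) + 1)} :=
      fun i j hij x hx => by
        have h1 : 1 / ((j : ℝ) + 1) ≤ 1 / ((i : ℝ) + 1) :=
          one_div_le_one_div_of_le (by positivity) (by gcongr)
        have h2 : g x ≤ sInf T - 1 / ((i : ℝ) + 1) := hx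
        exact h2.trans (by linarith)
    rw [hU, hmono.measure_iUnion]
    refine iSup_le fun n => ?_
    have h1 : μ {x | g x ≤ sInf T - 1 / ((n : ℝ) + 1)} = ρ (Iic (sInf T - 1 / ((n : ℝ) + 1))) := by
      rw [hρ, Measure.map_apply hg measurableSet_Iic]
      rfl
    rw [h1, ← ENNReal.ofReal_toReal (measure_ne_top ρ _), ← measureReal_def, ← hreal]
    refine ENNReal.ofReal_le_ofReal (le_of_not_ge fun hge => ?_)
    have h2 := csInf_le hbdd (show sInf T - 1 / ((n : ℝ) + 1) ∈ T from hge)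
    have h3 : (0 : ℝ) < 1 / ((n : ℝ) + 1) := by positivity
    linarith

/-- The distribution function of a sum of two functions with disjoint supports. -/
theorem measure_setOf_lt_add_of_disjoint (m : Measure S) {a b : S → ℝ} (hb : AEMeasurable b m)
    (hab : ∀ x, a x = 0 ∨ b x = 0) (t : ℝ≥0∞) :
    m {x | t < ENNReal.ofReal |a x + b x|} =
      m {x | t < ENNReal.ofReal |a x|} + m {x | t < ENNReal.ofReal |b x|} := by
  have hU : {x | t < ENNReal.ofReal |a x + b x|} =
      {x | t < ENNReal.ofReal |a x|} ∪ {x | t < ENNReal.ofReal |b x|} := by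
    ext x
    rcases hab x with h | h <;> simp [h]
  rw [hU, measure_union₀]
  · exact nullMeasurableSet_lt aemeasurable_const
      (ENNReal.measurable_ofReal.comp_aemeasurable hb.abs)
  · refine Disjoint.aedisjoint (disjoint_left.2 fun x hx hx' => ?_)
    rcases hab x with h | h
    · simp [h] at hx
    · simp [h] at hx'

theorem rearr_eq_zero_of_le {m : Measure S} {u : S → ℝ≥0∞} {s t : ℝ}
    (hs : m {x | 0 < u x} ≤ ENNReal.ofReal s) (hst : s ≤ t) : rearr m u t = 0 :=
  le_antisymm ((rearr_le_iff m u t 0).2 (hs.trans (ENNReal.ofReal_le_ofReal hst))) bot_le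

theorem ae_rearr_ne_top (m : Measure S) [IsProbabilityMeasure m] {u : S → ℝ≥0∞}
    (hu : Measurable u) (hfin : ∀ x, u x ≠ ∞) : ∀ᵐ t ∂leb, rearr m u t ≠ ∞ := by
  have : leb.map (rearr m u) {∞} = 0 := by
    rw [map_rearr m hu, Measure.map_apply hu (measurableSet_singleton _)]
    convert measure_empty (μ := m)
    ext x
    simp [hfin x]
  rw [Measure.map_apply (measurable_rearr m u) (measurableSet_singleton _)] at this
  refine ae_iff.2 (Eq.trans (congrArg leb ?_) this)
  ext t
  simp

theorem measurePreserving_one_sub : MeasurePreserving (fun t : ℝ => 1 - t) leb leb := by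
  have := (Measure.measurePreserving_sub_left (volume : Measure ℝ) 1).restrict_preimage
    (measurableSet_Ioo (a := (0 : ℝ)) (b := 1))
  simpa using this

theorem QRISpace.norm_comp_one_sub (Y : QRISpace) {f : ℝ → ℝ} (hf : Measurable f) :
    Y.norm (fun t => f (1 - t)) = Y.norm f := by
  refine Y.norm_congr _ _ (hf.comp measurePreserving_one_sub.measurable).aemeasurable
    hf.aemeasurable fun s _ => congrFun (rearr_congr fun t => ?_) s
  exact measurePreserving_one_sub.measure_preimage
    (measurableSet_lt measurable_const hf.abs.ennreal_ofReal).nullMeasurableSet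

/-- The rearrangement of a function vanishing off a set of measure `1/2` as a real function
supported on `(0, 1/2)`. -/
theorem ofReal_abs_indicator_rearr_ae_eq (m : Measure S) [IsProbabilityMeasure m] {u : S → ℝ≥0∞}
    (hu : Measurable u) (hfin : ∀ x, u x ≠ ∞) (hs : m {x | 0 < u x} ≤ ENNReal.ofReal (1 / 2)) :
    (fun t => ENNReal.ofReal |(Ioo (0 : ℝ) (1 / 2)).indicator
      (fun t => (rearr m u t).toReal) t|) =ᵐ[leb] rearr m u := by
  filter_upwards [ae_rearr_ne_top m hu hfin, ae_restrict_mem measurableSet_Ioo] with t ht ht'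
  by_cases h : t < 1 / 2
  · have hmem : t ∈ Ioo (0 : ℝ) (1 / 2) := ⟨ht'.1, h⟩
    rw [indicator_of_mem hmem,
      abs_of_nonneg ENNReal.toReal_nonneg, ENNReal.ofReal_toReal ht]
  · rw [indicator_of_notMem fun h' => h h'.2, rearr_eq_zero_of_le hs (not_lt.1 h)]
    simp

end Median

end ConvexIso

/-! ### The Sobolev-type inequality -/

open ConvexIso in
theorem theorem4p2 {Ω : Type*} [MetricSpace Ω] [ConnectedSpace Ω] [MeasurableSpace Ω] [BorelSpace Ω]
    (μ : MeasureTheory.Measure Ω) [MeasureTheory.IsProbabilityMeasure μ]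
    [MeasureTheory.IsSeparable μ] (hμ : ConvexIso.NonAtomic μ)
    (hgrad : ∀ f : Ω → ℝ, (∃ L : ℝ≥0, LipschitzWith L f) → ∀ c : ℝ,
      ∀ᵐ x ∂μ, f x = c → ConvexIso.gradMod f x = 0)
    (I : ℝ → ℝ) (hI : ConvexIso.IsConvexEstimator μ I)
    (X : ConvexIso.RISpace μ) (Y : ConvexIso.QRISpace)
    (hQ : ∃ C : ℝ≥0, 0 < C ∧ ∀ f : ℝ → ℝ, AEMeasurable f ConvexIso.leb →
      Y.norm (ConvexIso.hardyQ I f) ≤ C * X.barNorm f) :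
    ∃ K : ℝ≥0, ∀ g : Ω → ℝ, (∃ L : ℝ≥0, LipschitzWith L g) →
      ⨅ c : ℝ, Y.norm (fun t => (ConvexIso.rearr μ (fun x => ENNReal.ofReal |g x - c|) t).toReal) ≤
        K * X.norm (ConvexIso.gradMod g) := by
  obtain ⟨C, -, hC⟩ := hQ
  obtain ⟨K, hK⟩ := Y.norm_add_le
  obtain ⟨v, hv, hv0⟩ := hμ.exists_measurable_null_levels
  -- `K` is the quasi-triangle constant, and `2 * C` collects one Hardy bound for each side of the
  -- median.
  refine ⟨K * (2 * C), fun g ⟨L, hL⟩ => ?_⟩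
  have hgm := hL.continuous.measurable
  obtain ⟨m, hm1, hm2⟩ := exists_median μ hgm
  refine iInf_le_of_le m ?_
  have key : ∀ f : Ω → ℝ, LipschitzWith L f → (∀ x, 0 ≤ f x) →
      (∀ x y, |f x - f y| ≤ |g x - g y|) → μ {x | 0 < f x} ≤ ENNReal.ofReal (1 / 2) →
      Y.norm ((Ioo (0 : ℝ) (1 / 2)).indicator
        fun t => (rearr μ (fun x => ENNReal.ofReal (f x)) t).toReal) ≤
          C * X.norm (gradMod g) := fun f hf hf0 hfg hhalf => by
    obtain ⟨h, hhm, hQh, hbar⟩ := exists_hardyQ_eq_rearr μ hv hv0 hI hf hf0 hhalf (hgrad f ⟨L, hf⟩)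
    have : (Ioo (0 : ℝ) (1 / 2)).indicator
        (fun t => (rearr μ (fun x => ENNReal.ofReal (f x)) t).toReal) = hardyQ I h := by
      ext t
      by_cases ht : t ∈ Ioo (0 : ℝ) (1 / 2)
      · rw [indicator_of_mem ht, hQh t ht]
      · rw [hardyQ, indicator_of_notMem ht, indicator_of_notMem ht]
    rw [this]
    refine (hC h hhm.aemeasurable).trans ?_
    gcongr
    refine (hbar X).trans (X.norm_mono _ _ (measurable_gradMod hf.continuous).aemeasurable
      (measurable_gradMod hL.continuous).aemeasurable (Eventually.of_forall fun x => ?_))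
    exact gradMod_mono (hfg x)
  have hbound : ∀ x y, |max (g x - m) 0 - max (g y - m) 0| ≤ |g x - g y| := fun x y => by
    simpa using abs_max_sub_max_le_abs (g x - m) (g y - m) 0
  have hbound' : ∀ x y, |max (m - g x) 0 - max (m - g y) 0| ≤ |g x - g y| := fun x y => by
    simpa [abs_sub_comm] using abs_max_sub_max_le_abs (m - g x) (m - g y) 0
  have hlip : ∀ f : Ω → ℝ, (∀ x y, |f x - f y| ≤ |g x - g y|) → LipschitzWith L f :=
    fun f hf => LipschitzWith.of_dist_le_mul fun x y => (hf x y).trans (hL.dist_le_mul x y)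
  set f₁ : Ω → ℝ := fun x => max (g x - m) 0 with hf₁
  set f₂ : Ω → ℝ := fun x => max (m - g x) 0 with hf₂
  have hf₁m : Measurable f₁ := (hgm.sub_const m).max measurable_const
  have hf₂m : Measurable f₂ := (hgm.const_sub m).max measurable_const
  have hhalf₁ : μ {x | 0 < f₁ x} ≤ ENNReal.ofReal (1 / 2) := by simpa [hf₁] using hm1
  have hhalf₂ : μ {x | 0 < f₂ x} ≤ ENNReal.ofReal (1 / 2) := by simpa [hf₂] using hm2
  have hpos₁ : ∀ x, 0 ≤ f₁ x := fun x => le_max_right _ _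
  have hpos₂ : ∀ x, 0 ≤ f₂ x := fun x => le_max_right _ _
  have hb₁ := key f₁ (hlip f₁ hbound) hpos₁ hbound hhalf₁
  have hb₂ := key f₂ (hlip f₂ hbound') hpos₂ hbound' hhalf₂
  set r₁ := (Ioo (0 : ℝ) (1 / 2)).indicator
    fun t => (rearr μ (fun x => ENNReal.ofReal (f₁ x)) t).toReal with hr₁
  set r₂ := (Ioo (0 : ℝ) (1 / 2)).indicator
    fun t => (rearr μ (fun x => ENNReal.ofReal (f₂ x)) t).toReal with hr₂
  have hr₁m : Measurable r₁ := (measurable_rearr μ _).ennreal_toReal.indicator measurableSet_Ioo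
  have hr₂m : Measurable r₂ := (measurable_rearr μ _).ennreal_toReal.indicator measurableSet_Ioo
  have hr₂m' : Measurable fun t => r₂ (1 - t) := hr₂m.comp measurePreserving_one_sub.measurable
  have hUm : Measurable fun x => ENNReal.ofReal |g x - m| := (hgm.sub_const m).abs.ennreal_ofReal
  -- Reflecting `r₂` places it on `(1/2, 1)`, disjoint from `r₁`. Distribution functions then add,
  -- just as those of `f₁` and `f₂` do on `Ω`.
  have hdist : ∀ t, leb {s | t < ENNReal.ofReal
      |(rearr μ (fun x => ENNReal.ofReal |g x - m|) s).toReal|} =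
      leb {s | t < ENNReal.ofReal |r₁ s + r₂ (1 - s)|} := fun t => by
    have e1 : leb {s | t < ENNReal.ofReal
        |(rearr μ (fun x => ENNReal.ofReal |g x - m|) s).toReal|} =
        μ {x | t < ENNReal.ofReal |g x - m|} := by
      rw [← leb_setOf_lt_rearr μ]
      refine measure_congr ?_
      filter_upwards [ae_rearr_ne_top μ hUm fun x => ENNReal.ofReal_ne_top] with s hs
      refine congrArg (t < ·) ?_
      rw [abs_of_nonneg ENNReal.toReal_nonneg, ENNReal.ofReal_toReal hs]
    have e2 : μ {x | t < ENNReal.ofReal |g x - m|} =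
        μ {x | t < ENNReal.ofReal |f₁ x|} + μ {x | t < ENNReal.ofReal |f₂ x|} := by
      rw [← measure_setOf_lt_add_of_disjoint μ hf₂m.aemeasurable]
      · congr 1
        ext x
        simp only [mem_ofPred_eq, hf₁, hf₂]
        rcases le_total (g x) m with h | h
        · rw [max_eq_right (by linarith), max_eq_left (by linarith), zero_add, abs_sub_comm]
        · rw [max_eq_left (by linarith), max_eq_right (by linarith), add_zero]
      · intro x
        rcases le_total (g x) m with h | h
        · exact Or.inl (max_eq_right (by linarith))
        · exact Or.inr (max_eq_right (by linarith))
    have e3 : ∀ f : Ω → ℝ, Measurable f → (∀ x, 0 ≤ f x) →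
        μ {x | 0 < f x} ≤ ENNReal.ofReal (1 / 2) →
        leb {s | t < ENNReal.ofReal |(Ioo (0 : ℝ) (1 / 2)).indicator
          (fun t => (rearr μ (fun x => ENNReal.ofReal (f x)) t).toReal) s|} =
          μ {x | t < ENNReal.ofReal |f x|} := fun f hf hf0 hs => by
      simp_rw [fun x => abs_of_nonneg (hf0 x)]
      rw [← leb_setOf_lt_rearr μ]
      refine measure_congr ?_
      filter_upwards [ofReal_abs_indicator_rearr_ae_eq μ hf.ennreal_ofReal
        (fun x => ENNReal.ofReal_ne_top) (by simpa using hs)] with s hs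
      exact congrArg (t < ·) hs
    have e4 : leb {s | t < ENNReal.ofReal |r₂ (1 - s)|} = leb {s | t < ENNReal.ofReal |r₂ s|} :=
      measurePreserving_one_sub.measure_preimage
        (measurableSet_lt measurable_const hr₂m.abs.ennreal_ofReal).nullMeasurableSet
    rw [e1, e2, measure_setOf_lt_add_of_disjoint leb hr₂m'.aemeasurable, e4,
      e3 f₁ hf₁m hpos₁ hhalf₁, e3 f₂ hf₂m hpos₂ hhalf₂]
    intro s
    rcases le_or_gt (1 / 2) s with h | h
    · exact Or.inl (indicator_of_notMem (fun h' => h'.2.not_ge h) _)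
    · refine Or.inr (indicator_of_notMem (fun h' => ?_) _)
      have := h'.2
      linarith
  calc Y.norm (fun t => (rearr μ (fun x => ENNReal.ofReal |g x - m|) t).toReal)
      = Y.norm (fun t => r₁ t + r₂ (1 - t)) :=
        Y.norm_congr _ _ (measurable_rearr μ _).ennreal_toReal.aemeasurable
          (hr₁m.add hr₂m').aemeasurable fun s _ => congrFun (rearr_congr hdist) s
    _ ≤ K * (Y.norm r₁ + Y.norm (fun t => r₂ (1 - t))) :=
        hK _ _ hr₁m.aemeasurable hr₂m'.aemeasurable
    _ ≤ K * (C * X.norm (gradMod g) + C * X.norm (gradMod g)) := by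
        rw [Y.norm_comp_one_sub hr₂m]
        gcongr
    _ = (K * (2 * C) : ℝ≥0) * X.norm (gradMod g) := by
        push_cast
        ring
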